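/- All graphs are finite and simple. For a graph $G$ let $\rho(G)$ denote its spectral radius, that is, the spectral radius of its adjacency matrix. For a graph $F$, a graph is $F$-free if it has no (not necessarily induced) subgraph isomorphic to $F$, and $\mathrm{SPEX}_{\mathcal P}(m,F)$ denotes the set of graphs (up to isomorphism) attaining the maximum spectral radius among all $F$-free planar graphs with $m$ edges and no isolated vertices. Write $K_n$ for the complete graph on $n$ vertices, $C_l$ for the cycle on $l$ vertices, $tK_2$ for the disjoint union of $t$ copies of $K_2$ (and $kK_1$ for $k$ isolated vertices), $S_k$ for the star with $k$ edges, $\cup$ for disjoint union and $\vee$ for join. Let $G_m = K_2 \vee \frac{m-1}{2} K_1$ if $m$ is odd, and $G_m = K_1 \vee \left(S_{\frac{m-2}{2}} \cup K_1\right)$ if $m$ is even. **Corollary.** There is an integer $m_0$ such that for all $m \ge m_0$, all $l \ge 5$ and all $t \ge 3$, $$\mathrm{SPEX}_{\mathcal P}(m, C_l) = \mathrm{SPEX}_{\mathcal P}(m, K_4) = \mathrm{SPEX}_{\mathcal P}(m, tK_2) = \{G_m\}.$$ -/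

import Mathlib

namespace PlanarSpex

open SimpleGraph

universe u

/-- A drawing of the graph `G` in the plane `ℝ × ℝ`: distinct vertices are distinct points, every
edge is a simple arc joining the points of its two ends, an arc passes through no other vertex,
and two different arcs meet only in a common end. -/
structure PlaneDrawing {V : Type*} (G : SimpleGraph V) where
  point : V → ℝ × ℝ
  arc : G.edgeSet → C(unitInterval, ℝ × ℝ)
  point_injective : Function.Injective point
  arc_injective : ∀ e, Function.Injective (arc e)
  arc_ends : ∀ e : G.edgeSet, ({arc e 0, arc e 1} : Set (ℝ × ℝ)) = point '' {v | v ∈ e.1}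
  mem_of_arc_eq_point : ∀ (e : G.edgeSet) (t : unitInterval) (v : V), arc e t = point v → v ∈ e.1
  arcs_meet : ∀ (e f : G.edgeSet) (s t : unitInterval), e ≠ f → arc e s = arc f t →
    ∃ v, v ∈ e.1 ∧ v ∈ f.1 ∧ arc e s = point v

/-- A graph is planar if it can be drawn in the plane so that edges meet only at their ends. -/
def IsPlanar {V : Type*} (G : SimpleGraph V) : Prop := Nonempty (PlaneDrawing G)

open Classical in
/-- The spectral radius `ρ(G)` of a finite graph: the spectral radius of its adjacency matrix. -/
noncomputable def rho {V : Type*} [Fintype V] (G : SimpleGraph V) : ENNReal :=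
  spectralRadius ℂ (G.adjMatrix ℂ)

/-- The join `G ∨ H`: the disjoint union together with all edges between the two parts. -/
def join {V W : Type*} (G : SimpleGraph V) (H : SimpleGraph W) : SimpleGraph (V ⊕ W) :=
  (G ⊕g H) ⊔ completeBipartiteGraph V W

/-- The star `S_k` with `k` edges. -/
def star (k : ℕ) : SimpleGraph (Fin (k + 1)) := starGraph 0

/-- The matching `t K_2`: `t` disjoint copies of the graph `K_2`. -/
def matching (t : ℕ) : SimpleGraph (Fin t × Fin 2) where
  Adj x y := x.1 = y.1 ∧ x.2 ≠ y.2
  symm := ⟨fun _ _ h => ⟨h.1.symm, h.2.symm⟩⟩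
  loopless := ⟨fun _ h => h.2 rfl⟩

/-- `G` is (isomorphic to) `G_m`, that is, `K_2 ∨ ((m-1)/2) K_1` if `m` is odd and
`K_1 ∨ (S_{(m-2)/2} ∪ K_1)` if `m` is even. -/
def IsGm {V : Type*} (m : ℕ) (G : SimpleGraph V) : Prop :=
  if Odd m then
    Nonempty (G ≃g join (completeGraph (Fin 2)) (emptyGraph (Fin ((m - 1) / 2))))
  else
    Nonempty (G ≃g join (completeGraph (Fin 1)) (star ((m - 2) / 2) ⊕g completeGraph (Fin 1)))

/-- `G` is a planar `F`-free graph with `m` edges and no isolated vertices, where `F`-free means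
that no (not necessarily induced) subgraph of `G` is isomorphic to `F`. -/
structure IsAdmissible {V W : Type*} (m : ℕ) (F : SimpleGraph W) (G : SimpleGraph V) : Prop where
  planar : IsPlanar G
  card_edges : G.edgeSet.ncard = m
  not_isolated : ∀ v, ¬ G.IsIsolated v
  free : F.Free G

/-- `G` belongs to `SPEX_P(m, F)`: it has the maximum spectral radius among all finite planar
`F`-free graphs with `m` edges and no isolated vertices. -/
def IsSPEX {V : Type u} {W : Type*} [Fintype V] (m : ℕ) (F : SimpleGraph W)
    (G : SimpleGraph V) : Prop :=
  IsAdmissible m F G ∧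
    ∀ (V' : Type u) [Fintype V'] (G' : SimpleGraph V'), IsAdmissible m F G' → rho G' ≤ rho G

end PlanarSpex

namespace PlanarSpex

open SimpleGraph

/-! No forbidden graph has a vertex cover of size two, while every edge of $G_m$ meets one of the
two ends of its spine edge. Hence $G_m$ is admissible for each of them (`IsBook.free`,
`isPlanar_of_two_cover`), and it suffices that for large $m$ it is the unique maximiser among all
planar graphs with $m$ edges and no isolated vertices. Planarity enters this bound only by excluding
$K_{3,3}$ (`IsPlanar.not_hasK33`).

Test vectors on $G_m$ give $\rho^2-\rho\ge m-1.6$, and $\ge m-1$ for odd $m$, so a competitor has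
$\rho\ge\sqrt m$. Let $x$ be its unit Perron vector, $B$ the set of its boundedly many heavy
entries, $\beta$ their squared mass, and $x_u\ge x_v$ the two largest entries. Split $\rho=x^TAx$.
Edges inside $B$ contribute $O(1)$. Edges avoiding $B$ contribute little, because a $K_{3,3}$-free
graph with small vertex weights has small density (`density_cube_le`). Almost every vertex has at
most two neighbours in $B$, so the cut contributes about $2\sqrt m\sqrt{(1-\beta)(x_u^2+x_v^2)}$ at
most (`cut_form_le`). This reaches $\sqrt m$ only if $x_u^2+x_v^2$ is nearly $1/2$ and exhausts
$\beta$; hence every other entry is at most $x_u/10$ (`third_entry_le`).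

Finally, walks of length two from $u$ bound $\rho^2$ by $\rho$ plus an edge count in which each edge
outside the structure of $G_m$ loses too much. The graph is then a book with pendant vertices, whose
number is fixed by the size of $\rho$ and the parity of $m$ (`isBook_of_entries_le`). -/

/-! ### Continuous logarithms and the nonplanarity of $K_{3,3}$. -/

theorem exists_continuous_log {A : Type*} [TopologicalSpace A] [SimplyConnectedSpace A]
    [LocallyPathConnectedSpace A] (g : C(A, ℂ)) (hg : ∀ a, g a ≠ 0) :
    ∃ F : C(A, ℂ), ∀ a, Complex.exp (F a) = g a := by
  obtain ⟨a₀⟩ : Nonempty A := inferInstance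
  obtain ⟨F, ⟨-, hF⟩, -⟩ := Complex.isCoveringMapOn_exp.existsUnique_continuousMap_lifts g
    (a₀ := a₀) (Complex.exp_log (hg a₀)) hg
  exact ⟨F, fun a => congrFun hF a⟩

/-- `F - G` and a constant map lift the same constant through the covering `exp`, so they agree
everywhere once they agree at `t`. -/
theorem sub_eq_sub_of_exp_eq_mul_exp (F G : C(ℝ, ℂ)) (c : ℂ)
    (h : ∀ t, Complex.exp (F t) = c * Complex.exp (G t)) (s t : ℝ) :
    F s - F t = G s - G t := by
  have key : (fun r => F r - G r) = fun _ => F t - G t := by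
    refine Complex.isCoveringMap_exp.eq_of_comp_eq (by fun_prop) (by fun_prop) ?_ t rfl
    funext r
    simp only [Function.comp_apply, Subtype.mk.injEq, Complex.exp_sub, h]
    rw [mul_div_cancel_right₀ _ (Complex.exp_ne_zero _),
      mul_div_cancel_right₀ _ (Complex.exp_ne_zero _)]
  have := congrFun key s
  linear_combination this

open Classical in
/-- The change of a continuous logarithm of `δ - v` along the curve `δ` over `[0, 1]`. -/
noncomputable def logChange (v : ℂ) (δ : C(ℝ, ℂ)) : ℂ :=
  if h : ∃ L : C(ℝ, ℂ), ∀ t, Complex.exp (L t) = δ t - v then h.choose 1 - h.choose 0 else 0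

theorem exists_continuous_log_sub (v : ℂ) (δ : C(ℝ, ℂ)) (h : ∀ t, δ t ≠ v) :
    ∃ L : C(ℝ, ℂ), ∀ t, Complex.exp (L t) = δ t - v :=
  exists_continuous_log ⟨fun t => δ t - v, by fun_prop⟩ fun t => sub_ne_zero.2 (h t)

/-- The choice of logarithm does not matter, nor does a constant factor; `c = -1` allows `γ - δ` to
stand in for `δ - γ`. -/
theorem logChange_eq {v : ℂ} {δ : C(ℝ, ℂ)} (F : C(ℝ, ℂ)) (c : ℂ)
    (hF : ∀ t, Complex.exp (F t) = c * (δ t - v)) (h : ∀ t, δ t ≠ v) :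
    logChange v δ = F 1 - F 0 := by
  have hex := exists_continuous_log_sub v δ h
  rw [logChange, dif_pos hex]
  refine (sub_eq_sub_of_exp_eq_mul_exp F _ c (fun t => ?_) 1 0).symm
  rw [hex.choose_spec, hF]

theorem exists_logChange_eq_log_sub_log {v : ℂ} {δ : C(ℝ, ℂ)} (h : ∀ t, δ t ≠ v) :
    ∃ n : ℤ, logChange v δ =
      Complex.log (δ 1 - v) - Complex.log (δ 0 - v) + n * (2 * Real.pi * Complex.I) := by
  obtain ⟨L, hL⟩ := exists_continuous_log_sub v δ h
  rw [logChange_eq L 1 (by simpa using hL) h]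
  have h1 := sub_ne_zero.2 (h 1)
  have h0 := sub_ne_zero.2 (h 0)
  rw [← Complex.exp_eq_exp_iff_exists_int, Complex.exp_sub, Complex.exp_sub, hL, hL,
    Complex.exp_log h1, Complex.exp_log h0]

/-- The oddness of `σ` comes from $e^{\pi i}=-1$ and is the source of the parity obstruction. -/
theorem exists_log_sub_comm {v w : ℂ} (h : v ≠ w) :
    ∃ σ : ℤ, Odd σ ∧
      Complex.log (v - w) = Complex.log (w - v) + σ * (Real.pi * Complex.I) := by
  have h1 := sub_ne_zero.2 h
  have h2 := sub_ne_zero.2 h.symm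
  obtain ⟨n, hn⟩ := (Complex.exp_eq_exp_iff_exists_int (x := Complex.log (v - w))
    (y := Complex.log (w - v) + Real.pi * Complex.I)).1 (by
      rw [Complex.exp_add, Complex.exp_log h1, Complex.exp_log h2, Complex.exp_pi_mul_I]; ring)
  exact ⟨2 * n + 1, ⟨n, rfl⟩, by rw [hn]; push_cast; ring⟩

/-- A logarithm of `γ s - δ t` exists on the whole parameter plane, and its changes along the four
sides of the unit square cancel. -/
theorem logChange_square {γ δ : C(ℝ, ℂ)} (h : ∀ s t, γ s ≠ δ t) :
    logChange (γ 0) δ + logChange (δ 1) γ - logChange (γ 1) δ - logChange (δ 0) γ = 0 := by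
  obtain ⟨F, hF⟩ := exists_continuous_log (A := ℝ × ℝ) ⟨fun p => γ p.1 - δ p.2, by fun_prop⟩
    fun p => sub_ne_zero.2 (h p.1 p.2)
  simp only [ContinuousMap.coe_mk, Prod.forall] at hF
  rw [logChange_eq (v := γ 0) ⟨fun t => F (0, t), by fun_prop⟩ (-1)
      (by simp [hF]) fun t => (h 0 t).symm,
    logChange_eq (v := γ 1) ⟨fun t => F (1, t), by fun_prop⟩ (-1)
      (by simp [hF]) fun t => (h 1 t).symm,
    logChange_eq (v := δ 1) ⟨fun t => F (t, 1), by fun_prop⟩ 1 (by simp [hF]) fun t => h t 1,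
    logChange_eq (v := δ 0) ⟨fun t => F (t, 0), by fun_prop⟩ 1 (by simp [hF]) fun t => h t 0]
  simp only [ContinuousMap.coe_mk]
  ring

/-- The complete bipartite graph `K_{3,3}` cannot be mapped to the plane in such a way that
independent edges have disjoint images. -/
theorem not_disjoint_K33_curves (A B : Fin 3 → ℂ) (γ : Fin 3 → Fin 3 → C(ℝ, ℂ))
    (h0 : ∀ i j, γ i j 0 = A i) (h1 : ∀ i j, γ i j 1 = B j)
    (hd : ∀ i j k l, i ≠ k → j ≠ l → ∀ s t, γ i j s ≠ γ k l t) : False := by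
  have other : ∀ j : Fin 3, ∃ l, j ≠ l := by decide
  -- `A i` is an end of some `γ i j` with `j ≠ l`, a curve independent of `γ k l`.
  have hA : ∀ i k l, i ≠ k → ∀ t, γ k l t ≠ A i := fun i k l hik t => by
    obtain ⟨j, hj⟩ := other l
    simpa [h0] using (hd i j k l hik hj.symm 0 t).symm
  have hB : ∀ j k l, j ≠ l → ∀ t, γ k l t ≠ B j := fun j k l hjl t => by
    obtain ⟨i, hi⟩ := other k
    simpa [h1] using (hd i j k l hi.symm hjl 1 t).symm
  -- The value 0 for `i = k` is a dummy that lets `choose` produce a total function.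
  have hn : ∀ i k l, ∃ n : ℤ, i ≠ k → logChange (A i) (γ k l) = Complex.log (B l - A i)
      - Complex.log (A k - A i) + n * (2 * Real.pi * Complex.I) := fun i k l => by
    by_cases hik : i = k
    · exact ⟨0, fun h => (h hik).elim⟩
    · obtain ⟨n, hn⟩ := exists_logChange_eq_log_sub_log (hA i k l hik)
      exact ⟨n, fun _ => by rw [hn, h0, h1]⟩
  have hm : ∀ j k l, ∃ n : ℤ, j ≠ l → logChange (B j) (γ k l) = Complex.log (B l - B j)
      - Complex.log (A k - B j) + n * (2 * Real.pi * Complex.I) := fun j k l => by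
    by_cases hjl : j = l
    · exact ⟨0, fun h => (h hjl).elim⟩
    · obtain ⟨n, hn⟩ := exists_logChange_eq_log_sub_log (hB j k l hjl)
      exact ⟨n, fun _ => by rw [hn, h0, h1]⟩
  have hσ : ∀ f : Fin 3 → ℂ, Function.Injective f → ∀ i k, ∃ σ : ℤ, i ≠ k → Odd σ ∧
      Complex.log (f i - f k) = Complex.log (f k - f i) + σ * (Real.pi * Complex.I) :=
    fun f hf i k => by
      by_cases hik : i = k
      · exact ⟨0, fun h => (h hik).elim⟩
      · obtain ⟨σ, hσ⟩ := exists_log_sub_comm (hf.ne hik)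
        exact ⟨σ, fun _ => hσ⟩
  have hAi : Function.Injective A := fun i k h => by
    by_contra hik
    exact hA i k 0 hik 0 (by rw [h0, h])
  have hBi : Function.Injective B := fun j l h => by
    by_contra hjl
    exact hB j 0 l hjl 1 (by rw [h1, h])
  have hAB : ∀ i j, A i ≠ B j := fun i j h => by
    obtain ⟨k, hk⟩ := other i
    exact hA i k j hk 1 (by rw [h1, h])
  choose n hn using hn
  choose m hm using hm
  choose a ha using hσ A hAi
  choose b hb using hσ B hBi
  choose c hc' hc using fun i j => exists_log_sub_comm (hAB i j)
  have hpi : (Real.pi * Complex.I : ℂ) ≠ 0 := by simp [Real.pi_ne_zero]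
  have hbanti : ∀ j l, j ≠ l → b j l + b l j = 0 := fun j l hjl => by
    have e1 := (hb j l hjl).2
    have e2 := (hb l j hjl.symm).2
    have : ((b j l + b l j : ℤ) : ℂ) * (Real.pi * Complex.I) = 0 := by
      push_cast; linear_combination -e1 - e2
    exact_mod_cast (mul_eq_zero.1 this).resolve_right hpi
  -- The square relation in units of $\pi i$: the principal logarithms cancel, leaving the swap
  -- terms and even integers.
  have main : ∀ i j k l, i ≠ k → j ≠ l → a i k + b j l - c i l + c k j
      + 2 * (n i k l + m l i j - m j k l - n k i j) = 0 := fun i j k l hik hjl => by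
    have e := logChange_square (hd i j k l hik hjl)
    rw [h0, h0, h1, h1, hn i k l hik, hm l i j hjl.symm, hm j k l hjl, hn k i j hik.symm] at e
    have e1 := (ha i k hik).2
    have e2 := (hb j l hjl).2
    have e3 := hc i l
    have e4 := hc k j
    have : ((a i k + b j l - c i l + c k j
        + 2 * (n i k l + m l i j - m j k l - n k i j) : ℤ) : ℂ) * (Real.pi * Complex.I) = 0 := by
      push_cast
      linear_combination e - e1 - e2 + e3 - e4
    exact_mod_cast (mul_eq_zero.1 this).resolve_right hpi
  -- Sum `main` over the six ordered pairs `j ≠ l`: the `b` terms cancel by antisymmetry, each `n`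
  -- term occurs twice, and the `c` and `m` terms become differences of a quantity of `i` and the
  -- same quantity of `k`.
  have pair : ∀ i k, i ≠ k → ∃ q : ℤ, 6 * a i k + 2 * ((c k 0 + c k 1 + c k 2)
      - (c i 0 + c i 1 + c i 2)) + 2 * (2 * q
      + ∑ l, ∑ j, if j ≠ l then m l i j - m j k l else 0) = 0 := fun i k hik => by
    have e01 := main i 0 k 1 hik (by decide)
    have e02 := main i 0 k 2 hik (by decide)
    have e10 := main i 1 k 0 hik (by decide)
    have e12 := main i 1 k 2 hik (by decide)
    have e20 := main i 2 k 0 hik (by decide)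
    have e21 := main i 2 k 1 hik (by decide)
    have b1 := hbanti 0 1 (by decide)
    have b2 := hbanti 0 2 (by decide)
    have b3 := hbanti 1 2 (by decide)
    refine ⟨∑ l, (n i k l - n k i l), ?_⟩
    simp [Fin.sum_univ_three]
    linarith
  obtain ⟨q1, p1⟩ := pair 0 1 (by decide)
  obtain ⟨q2, p2⟩ := pair 0 2 (by decide)
  obtain ⟨q3, p3⟩ := pair 1 2 (by decide)
  obtain ⟨z1, hz1⟩ := (ha 0 1 (by decide)).1
  obtain ⟨z2, hz2⟩ := (ha 0 2 (by decide)).1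
  obtain ⟨z3, hz3⟩ := (ha 1 2 (by decide)).1
  choose z hz using hc'
  simp [Fin.sum_univ_three, hz] at p1 p2 p3
  -- In `p1 + p3 - p2` the `c` and `m` terms telescope; half of what remains says that three times
  -- the odd number `a 0 1 + a 1 2 - a 0 2` is even.
  omega

/-- The arc is reversed if it starts at `b`, and `Set.projIcc` extends it to the real line by
constants, the form required by the logarithm lemmas. -/
theorem PlaneDrawing.exists_oriented_arc {V : Type*} {G : SimpleGraph V} (D : PlaneDrawing G)
    {a b : V} (h : G.Adj a b) :
    ∃ γ : C(ℝ, ℂ), γ 0 = Complex.equivRealProdCLM.symm (D.point a) ∧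
      γ 1 = Complex.equivRealProdCLM.symm (D.point b) ∧
      ∀ t, ∃ s, γ t = Complex.equivRealProdCLM.symm (D.arc ⟨s(a, b), G.mem_edgeSet.2 h⟩ s) := by
  set α := D.arc ⟨s(a, b), G.mem_edgeSet.2 h⟩ with hα
  have hends : ({α 0, α 1} : Set (ℝ × ℝ)) = {D.point a, D.point b} := by
    rw [hα, D.arc_ends]
    ext z
    simp [eq_comm]
  rcases Set.pair_eq_pair_iff.1 hends with ⟨h0, h1⟩ | ⟨h0, h1⟩
  · refine ⟨⟨fun t => Complex.equivRealProdCLM.symm (α (Set.projIcc 0 1 zero_le_one t)),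
      by fun_prop⟩, ?_, ?_, fun t => ⟨_, rfl⟩⟩
    · simp only [ContinuousMap.coe_mk, Set.projIcc_left, ← h0]; rfl
    · simp only [ContinuousMap.coe_mk, Set.projIcc_right, ← h1]; rfl
  · refine ⟨⟨fun t => Complex.equivRealProdCLM.symm
      (α (unitInterval.symm (Set.projIcc 0 1 zero_le_one t))),
      by fun_prop⟩, ?_, ?_, fun t => ⟨_, rfl⟩⟩
    · simp only [ContinuousMap.coe_mk, Set.projIcc_left, ← h1]
      exact congrArg _ (congrArg _ unitInterval.symm_zero)
    · simp only [ContinuousMap.coe_mk, Set.projIcc_right, ← h0]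
      exact congrArg _ (congrArg _ unitInterval.symm_one)

/-- `G` contains the complete bipartite graph `K_{3,3}`. -/
def HasK33 {V : Type*} (G : SimpleGraph V) : Prop :=
  ∃ A B : Fin 3 → V, Function.Injective A ∧ Function.Injective B ∧ ∀ i j, G.Adj (A i) (B j)

theorem IsPlanar.not_hasK33 {V : Type*} {G : SimpleGraph V} (hG : IsPlanar G) : ¬ HasK33 G := by
  rintro ⟨A, B, hA, hB, hAB⟩
  obtain ⟨D⟩ := hG
  choose γ h0 h1 hγ using fun i j => D.exists_oriented_arc (hAB i j)
  refine not_disjoint_K33_curves _ _ γ h0 h1 fun i j k l hik hjl s t h => ?_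
  obtain ⟨s', hs⟩ := hγ i j s
  obtain ⟨t', ht⟩ := hγ k l t
  rw [hs, ht] at h
  have hik' := hA.ne hik
  have hjl' := hB.ne hjl
  have hil := (hAB i l).ne
  have hkj := (hAB k j).ne
  obtain ⟨v, hv1, hv2, -⟩ := D.arcs_meet ⟨s(A i, B j), G.mem_edgeSet.2 (hAB i j)⟩
    ⟨s(A k, B l), G.mem_edgeSet.2 (hAB k l)⟩ s' t'
    (by rw [Ne, Subtype.mk.injEq, Sym2.eq_iff]; tauto) (Complex.equivRealProdCLM.symm.injective h)
  simp only [Sym2.mem_iff] at hv1 hv2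
  grind

/-! ### The spectral radius and a Perron vector. -/

section
open scoped Matrix.Norms.L2Operator

open Classical in
theorem rho_eq_of_iso {V W : Type*} [Fintype V] [Fintype W] {G : SimpleGraph V}
    {H : SimpleGraph W} (e : G ≃g H) : rho G = rho H := by
  have h : Matrix.reindexAlgEquiv ℂ ℂ e.toEquiv (G.adjMatrix ℂ) = H.adjMatrix ℂ := by
    ext a b
    simp only [Matrix.coe_reindexAlgEquiv, Matrix.reindex_apply, Matrix.submatrix_apply,
      SimpleGraph.adjMatrix_apply]
    show (if _ then (1 : ℂ) else 0) = if _ then (1 : ℂ) else 0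
    refine if_congr ?_ rfl rfl
    rw [← e.map_adj_iff]
    exact iff_of_eq (congrArg₂ _ (e.apply_symm_apply a) (e.apply_symm_apply b))
  unfold rho spectralRadius
  rw [← h, AlgEquiv.spectrum_eq]

theorem adjMatrix_isSelfAdjoint {V : Type*} [Fintype V] (G : SimpleGraph V)
    [DecidableRel G.Adj] : IsSelfAdjoint (G.adjMatrix ℂ) := by
  ext a b
  simp [Matrix.star_apply, SimpleGraph.adjMatrix_apply, G.adj_comm, apply_ite]

open Classical in
theorem rho_eq_nnnorm {V : Type*} [Fintype V] (G : SimpleGraph V) :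
    rho G = ‖G.adjMatrix ℂ‖₊ :=
  (adjMatrix_isSelfAdjoint G).spectralRadius_eq_nnnorm

open Classical in
/-- A nonnegative vector with `A x ≥ μ x` bounds the spectral radius from below. -/
theorem le_rho_of_subeigenvector {V : Type*} [Fintype V] (G : SimpleGraph V) {μ : ℝ}
    (hμ : 0 ≤ μ) (x : V → ℝ) (hx : ∀ a, 0 ≤ x a) (hx0 : ∃ a, x a ≠ 0)
    (h : ∀ a, μ * x a ≤ ∑ b, if G.Adj a b then x b else 0) : ENNReal.ofReal μ ≤ rho G := by
  rw [rho_eq_nnnorm, ENNReal.ofReal, ENNReal.coe_le_coe, Real.toNNReal_le_iff_le_coe, coe_nnnorm]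
  set z : EuclideanSpace ℂ V := WithLp.toLp 2 fun a => (x a : ℂ) with hz
  have hle := Matrix.l2_opNorm_mulVec (G.adjMatrix ℂ) z
  have hzn : ‖z‖ ≠ 0 := by
    obtain ⟨a, ha⟩ := hx0
    rw [norm_ne_zero_iff]
    intro h0
    apply ha
    have := congrArg (fun y : EuclideanSpace ℂ V => y a) h0
    simpa [hz] using this
  have hge : μ * ‖z‖ ≤ ‖WithLp.toLp 2 ((G.adjMatrix ℂ).mulVec z.ofLp)‖ := by
    have : ‖(μ : ℂ) • z‖ ≤ ‖(WithLp.toLp 2 ((G.adjMatrix ℂ).mulVec z.ofLp) : EuclideanSpace ℂ V)‖ := by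
      rw [EuclideanSpace.norm_eq, EuclideanSpace.norm_eq]
      refine Real.sqrt_le_sqrt (Finset.sum_le_sum fun a _ => ?_)
      have e : (G.adjMatrix ℂ).mulVec z.ofLp a
          = ((∑ b, if G.Adj a b then x b else 0 : ℝ) : ℂ) := by
        simp [Matrix.mulVec, dotProduct, SimpleGraph.adjMatrix_apply, hz, apply_ite]
      have hxa := hx a
      have := h a
      gcongr
      have e' : (WithLp.toLp 2 ((G.adjMatrix ℂ).mulVec z.ofLp) : EuclideanSpace ℂ V).ofLp a
          = ((∑ b, if G.Adj a b then x b else 0 : ℝ) : ℂ) := e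
      rw [e']
      simp only [PiLp.smul_apply, hz, smul_eq_mul, ← Complex.ofReal_mul, Complex.norm_real,
        Real.norm_eq_abs]
      rw [abs_of_nonneg (by positivity), abs_of_nonneg (le_trans (by positivity) this)]
      exact this
    rwa [norm_smul, Complex.norm_real, Real.norm_eq_abs, abs_of_nonneg hμ] at this
  have : μ * ‖z‖ ≤ ‖G.adjMatrix ℂ‖ * ‖z‖ := hge.trans hle
  exact le_of_mul_le_mul_right this (lt_of_le_of_ne (norm_nonneg _) hzn.symm)

open Classical in
/-- The spectral radius is an eigenvalue with a nonnegative eigenvector. -/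
theorem exists_eigenvector_rho {V : Type*} [Fintype V] [Nonempty V] (G : SimpleGraph V) :
    ∃ (r : ℝ) (x : V → ℝ), 0 ≤ r ∧ rho G = ENNReal.ofReal r ∧ (∀ a, 0 ≤ x a) ∧ (∃ a, x a ≠ 0) ∧
      ∀ a, (∑ b, if G.Adj a b then x b else 0) = r * x a := by
  set A := G.adjMatrix ℂ with hA
  obtain ⟨k, hk, hkr⟩ := spectrum.exists_nnnorm_eq_spectralRadius A
  have hr : ‖k‖ = ‖A‖ := by
    have : (‖k‖₊ : ENNReal) = ‖A‖₊ :=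
      hkr.trans (adjMatrix_isSelfAdjoint G).spectralRadius_eq_nnnorm
    exact congrArg NNReal.toReal (ENNReal.coe_injective this)
  have hk' : k ∈ spectrum ℂ (Matrix.toLin' A) := by
    rwa [Matrix.spectrum_toLin']
  obtain ⟨z, hz⟩ := (Module.End.hasEigenvalue_iff_mem_spectrum.2 hk').exists_hasEigenvector
  have hz0 := hz.2
  have hzA : A.mulVec z = k • z := by simpa using hz.apply_eq_smul
  refine ⟨‖A‖, fun a => ‖z a‖, norm_nonneg _, ?_, fun a => norm_nonneg _, ?_, ?_⟩
  · rw [rho_eq_nnnorm, ← hA, ← coe_nnnorm, ENNReal.ofReal_coe_nnreal]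
  · by_contra! h
    exact hz0 (funext fun a => by simpa using h a)
  -- Triangle inequality applied to `A z = k z` with `‖k‖ = ‖A‖`.
  have hge : ∀ a, ‖A‖ * ‖z a‖ ≤ ∑ b, if G.Adj a b then ‖z b‖ else 0 := fun a => by
    have := congrArg (fun w : V → ℂ => ‖w a‖) hzA
    simp only [Pi.smul_apply, smul_eq_mul, norm_mul, hr] at this
    rw [← this]
    simp only [Matrix.mulVec, dotProduct, hA, SimpleGraph.adjMatrix_apply, ite_mul, one_mul,
      zero_mul]
    refine (norm_sum_le _ _).trans (Finset.sum_le_sum fun b _ => ?_)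
    split_ifs <;> simp
  set y : EuclideanSpace ℂ V := WithLp.toLp 2 fun a => (‖z a‖ : ℂ) with hy
  have hle := Matrix.l2_opNorm_mulVec A y
  have e : ∀ a, A.mulVec y.ofLp a = ((∑ b, if G.Adj a b then ‖z b‖ else 0 : ℝ) : ℂ) := fun a => by
    simp [Matrix.mulVec, dotProduct, SimpleGraph.adjMatrix_apply, hA, hy, apply_ite]
  have hsq : ∑ a, (∑ b, if G.Adj a b then ‖z b‖ else 0) ^ 2 ≤ ∑ a, (‖A‖ * ‖z a‖) ^ 2 := by
    have h2 := pow_le_pow_left₀ (norm_nonneg _) hle 2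
    rw [mul_pow, EuclideanSpace.norm_sq_eq, EuclideanSpace.norm_sq_eq, Finset.mul_sum] at h2
    refine le_trans (le_of_eq ?_) (h2.trans (le_of_eq ?_))
    · refine Finset.sum_congr rfl fun a _ => ?_
      have e' : ((EuclideanSpace.equiv V ℂ).symm (A.mulVec y.ofLp)).ofLp a
          = ((∑ b, if G.Adj a b then ‖z b‖ else 0 : ℝ) : ℂ) := e a
      rw [e', Complex.norm_real, Real.norm_eq_abs, sq_abs]
    · refine Finset.sum_congr rfl fun a _ => ?_
      simp [hy, mul_pow]
  have hterm : ∀ a ∈ Finset.univ, (‖A‖ * ‖z a‖) ^ 2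
      ≤ (∑ b, if G.Adj a b then ‖z b‖ else 0) ^ 2 := fun a _ =>
    pow_le_pow_left₀ (by positivity) (hge a) 2
  -- The operator norm bound reverses the sum of the squared entrywise inequalities, so each of them
  -- is an equality.
  have heq := (Finset.sum_eq_sum_iff_of_le hterm).1 (le_antisymm (Finset.sum_le_sum hterm) hsq)
  intro a
  have h := heq a (Finset.mem_univ a)
  exact ((pow_left_inj₀ (by positivity) (le_trans (by positivity) (hge a)) two_ne_zero).1 h).symm

end

open Classical in
/-- The real adjacency indicator. -/
noncomputable def adjInd {V : Type*} (G : SimpleGraph V) (a b : V) : ℝ := if G.Adj a b then 1 else 0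

section adjInd

variable {V : Type*} (G : SimpleGraph V)

theorem adjInd_comm (a b : V) : adjInd G a b = adjInd G b a := by
  unfold adjInd
  by_cases h : G.Adj a b
  · rw [if_pos h, if_pos h.symm]
  · rw [if_neg h, if_neg fun h' => h h'.symm]

theorem adjInd_nonneg (a b : V) : 0 ≤ adjInd G a b := by
  unfold adjInd; split_ifs <;> norm_num

theorem adjInd_le_one (a b : V) : adjInd G a b ≤ 1 := by
  unfold adjInd; split_ifs <;> norm_num

theorem adjInd_sq (a b : V) : adjInd G a b ^ 2 = adjInd G a b := by
  unfold adjInd; split_ifs <;> norm_num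

end adjInd

/-! ### Edge density of weighted $K_{3,3}$-free graphs. -/

section K33free

variable {V : Type*} [Fintype V] {G : SimpleGraph V}

open Classical in
theorem card_common_le_two (hG : ¬ HasK33 G) {b c d : V} (hbc : b ≠ c) (hbd : b ≠ d)
    (hcd : c ≠ d) :
    (Finset.univ.filter fun a => G.Adj a b ∧ G.Adj a c ∧ G.Adj a d).card ≤ 2 := by
  by_contra! h
  obtain ⟨a₁, a₂, a₃, h1, h2, h3, h12, h13, h23⟩ := Finset.two_lt_card_iff.1 h
  simp only [Finset.mem_filter, Finset.mem_univ, true_and] at h1 h2 h3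
  refine hG ⟨![a₁, a₂, a₃], ![b, c, d], ?_, ?_, ?_⟩
  · intro i j; fin_cases i <;> fin_cases j <;> simp_all [eq_comm]
  · intro i j; fin_cases i <;> fin_cases j <;> simp_all [eq_comm]
  · intro i j; fin_cases i <;> fin_cases j <;> simp_all

-- Three distinct vertices have at most two common neighbours, each of weight at most `δ`.
-- Coincidences get the trivial bound 1, which is affordable because they are rare under the weights
-- `p`.
open Classical in
theorem common_weight_le (hG : ¬ HasK33 G) {p : V → ℝ} {δ : ℝ} (hp : ∀ a, 0 ≤ p a)
    (hδ : ∀ a, p a ≤ δ) (hsum : ∑ a, p a ≤ 1) (b c d : V) :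
    ∑ a, p a * (adjInd G a b * adjInd G a c * adjInd G a d)
      ≤ 2 * δ + (if b = c then 1 else 0) + (if b = d then 1 else 0) + if c = d then 1 else 0 := by
  have hδ0 : 0 ≤ δ := (hp b).trans (hδ b)
  have hone : ∑ a, p a * (adjInd G a b * adjInd G a c * adjInd G a d) ≤ 1 := by
    refine (Finset.sum_le_sum fun a _ => ?_).trans hsum
    refine mul_le_of_le_one_right (hp a) (mul_le_one₀ (mul_le_one₀ (adjInd_le_one ..)
      (adjInd_nonneg ..) (adjInd_le_one ..)) (adjInd_nonneg ..) (adjInd_le_one ..))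
  by_cases hbc : b = c
  · rw [if_pos hbc]; refine hone.trans ?_; split_ifs <;> linarith
  by_cases hbd : b = d
  · rw [if_pos hbd]; refine hone.trans ?_; split_ifs <;> linarith
  by_cases hcd : c = d
  · rw [if_pos hcd]; refine hone.trans ?_; split_ifs; linarith
  simp only [if_neg hbc, if_neg hbd, if_neg hcd, add_zero]
  calc ∑ a, p a * (adjInd G a b * adjInd G a c * adjInd G a d)
      = ∑ a ∈ Finset.univ.filter (fun a => G.Adj a b ∧ G.Adj a c ∧ G.Adj a d), p a := by
        rw [Finset.sum_filter]
        refine Finset.sum_congr rfl fun a _ => ?_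
        unfold adjInd
        split_ifs <;> simp_all
    _ ≤ ((Finset.univ.filter fun a => G.Adj a b ∧ G.Adj a c ∧ G.Adj a d).card : ℕ) • δ :=
        Finset.sum_le_card_nsmul _ _ _ fun a _ => hδ a
    _ ≤ 2 * δ := by
        rw [nsmul_eq_mul]
        have := card_common_le_two hG hbc hbd hcd
        gcongr
        exact_mod_cast this

/-- A weighted graph without `K_{3,3}` and with small weights has small edge density. -/
theorem density_cube_le (hG : ¬ HasK33 G) {p : V → ℝ} {δ : ℝ} (hp : ∀ a, 0 ≤ p a)
    (hδ : ∀ a, p a ≤ δ) (hsum : ∑ a, p a ≤ 1) (hδ0 : 0 ≤ δ) :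
    (∑ a, p a * ∑ b, adjInd G a b * p b) ^ 3 ≤ 5 * δ := by
  classical
  set f : V → ℝ := fun a => ∑ b, adjInd G a b * p b with hf
  set q := ∑ a, p a * f a with hq
  have hf0 : ∀ a, 0 ≤ f a := fun a =>
    Finset.sum_nonneg fun b _ => mul_nonneg (adjInd_nonneg ..) (hp b)
  have hq0 : 0 ≤ q := Finset.sum_nonneg fun a _ => mul_nonneg (hp a) (hf0 a)
  -- Jensen for the cube, by its tangent $t^3\ge 3q^2t-2q^3$ at $q$; it survives total weight below
  -- 1.
  have h1 : q ^ 3 ≤ ∑ a, p a * f a ^ 3 := by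
    have h : ∑ a, p a * (3 * q ^ 2 * f a - 2 * q ^ 3) ≤ ∑ a, p a * f a ^ 3 := by
      refine Finset.sum_le_sum fun a _ => mul_le_mul_of_nonneg_left ?_ (hp a)
      nlinarith [mul_nonneg (add_nonneg (hf0 a) (mul_nonneg zero_le_two hq0)) (sq_nonneg (f a - q))]
    have e : ∑ a, p a * (3 * q ^ 2 * f a - 2 * q ^ 3)
        = 3 * q ^ 2 * q - 2 * q ^ 3 * ∑ a, p a := by
      rw [hq, Finset.mul_sum, Finset.mul_sum, ← Finset.sum_sub_distrib]
      exact Finset.sum_congr rfl fun a _ => by ring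
    rw [e] at h
    have : q ^ 3 * ∑ a, p a ≤ q ^ 3 := mul_le_of_le_one_right (pow_nonneg hq0 3) hsum
    linarith
  have h2 : ∑ a, p a * f a ^ 3 = ∑ b, ∑ c, ∑ d, p b * p c * p d *
      ∑ a, p a * (adjInd G a b * adjInd G a c * adjInd G a d) := by
    have e : ∀ a, p a * f a ^ 3 = ∑ b, ∑ c, ∑ d, p b * p c * p d *
        (p a * (adjInd G a b * adjInd G a c * adjInd G a d)) := fun a => by
      rw [pow_succ, pow_two, hf, Finset.sum_mul_sum, Finset.sum_mul, Finset.mul_sum]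
      refine Finset.sum_congr rfl fun b _ => ?_
      rw [Finset.sum_mul_sum, Finset.mul_sum]
      refine Finset.sum_congr rfl fun c _ => ?_
      rw [Finset.mul_sum]
      exact Finset.sum_congr rfl fun d _ => by ring
    simp_rw [e, Finset.mul_sum]
    rw [Finset.sum_comm]
    refine Finset.sum_congr rfl fun b _ => ?_
    rw [Finset.sum_comm]
    refine Finset.sum_congr rfl fun c _ => ?_
    rw [Finset.sum_comm]
  have h3 : ∑ b, ∑ c, ∑ d, p b * p c * p d *
      ∑ a, p a * (adjInd G a b * adjInd G a c * adjInd G a d) ≤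
      ∑ b, ∑ c, ∑ d, p b * p c * p d *
        (2 * δ + (if b = c then 1 else 0) + (if b = d then 1 else 0) + if c = d then 1 else 0) := by
    refine Finset.sum_le_sum fun b _ => Finset.sum_le_sum fun c _ => Finset.sum_le_sum fun d _ => ?_
    exact mul_le_mul_of_nonneg_left (common_weight_le hG hp hδ hsum b c d)
      (mul_nonneg (mul_nonneg (hp b) (hp c)) (hp d))
  -- Each of the three coincidences will cost at most `δ`, which gives $2\delta+3\delta$.
  have h4 : ∑ b, ∑ c, ∑ d, p b * p c * p d *
        (2 * δ + (if b = c then 1 else 0) + (if b = d then 1 else 0) + if c = d then 1 else 0)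
      = 2 * δ * (∑ b, p b) ^ 3 + 3 * ((∑ b, p b * p b) * ∑ b, p b) := by
    have e : ∀ b, ∑ c, ∑ d, p b * p c * p d *
        (2 * δ + (if b = c then 1 else 0) + (if b = d then 1 else 0) + if c = d then 1 else 0)
        = p b * (2 * δ * (∑ b, p b) ^ 2) + 2 * (p b * p b * ∑ b, p b) + p b * ∑ c, p c * p c := by
      intro b
      have e' : ∀ c, ∑ d, p b * p c * p d *
          (2 * δ + (if b = c then 1 else 0) + (if b = d then 1 else 0) + if c = d then 1 else 0)
          = p c * (p b * (2 * δ * ∑ d, p d)) + (if b = c then p b * p c * ∑ d, p d else 0)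
            + p c * (p b * p b) + p b * (p c * p c) := by
        intro c
        simp only [mul_add, Finset.sum_add_distrib, mul_ite, mul_one, mul_zero,
          Finset.sum_ite_eq, Finset.mem_univ, if_true]
        have : ∀ r : ℝ, ∑ d, p b * p c * p d * r = p b * p c * r * ∑ d, p d := fun r => by
          rw [Finset.mul_sum]; exact Finset.sum_congr rfl fun d _ => by ring
        rw [this]
        by_cases h : b = c
        · simp only [h, if_true, ← Finset.mul_sum]; ring
        · simp only [h, if_false, Finset.sum_const_zero]; ring
      simp_rw [e', Finset.sum_add_distrib, ← Finset.sum_mul, ← Finset.mul_sum,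
        Finset.sum_ite_eq, Finset.mem_univ, if_true]
      ring
    simp_rw [e, Finset.sum_add_distrib, ← Finset.mul_sum, ← Finset.sum_mul]
    ring
  have h5 : ∑ b, p b * p b ≤ δ := by
    calc ∑ b, p b * p b ≤ ∑ b, p b * δ :=
          Finset.sum_le_sum fun b _ => mul_le_mul_of_nonneg_left (hδ b) (hp b)
      _ = (∑ b, p b) * δ := by rw [Finset.sum_mul]
      _ ≤ δ := mul_le_of_le_one_left hδ0 hsum
  have hs0 : 0 ≤ ∑ b, p b := Finset.sum_nonneg fun b _ => hp b
  have h6 : (∑ b, p b * p b) * ∑ b, p b ≤ δ * 1 :=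
    mul_le_mul h5 hsum hs0 hδ0
  have h7 : 2 * δ * (∑ b, p b) ^ 3 ≤ 2 * δ :=
    mul_le_of_le_one_right (by positivity) (pow_le_one₀ hs0 hsum)
  linarith [h2.trans_le (h3.trans h4.le)]

/-- A quadratic form bound for vectors with small entries. -/
theorem quadratic_form_sq_le (hG : ¬ HasK33 G) {y : V → ℝ} {τ m : ℝ} (hτ : 0 ≤ τ)
    (hδ : ∀ a, 5 * y a ^ 2 ≤ τ ^ 3) (hsum : ∑ a, y a ^ 2 ≤ 1)
    (hm : ∑ a, ∑ b, adjInd G a b = 2 * m) :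
    (∑ a, ∑ b, adjInd G a b * (y a * y b)) ^ 2 ≤ 2 * m * τ := by
  have hq := density_cube_le hG (p := fun a => y a ^ 2) (δ := τ ^ 3 / 5) (fun a => sq_nonneg _)
    (fun a => by linarith [hδ a]) hsum (by positivity)
  have hq' : ∑ a, y a ^ 2 * ∑ b, adjInd G a b * y b ^ 2 ≤ τ :=
    le_of_pow_le_pow_left₀ three_ne_zero hτ (hq.trans_eq (by ring))
  -- Cauchy–Schwarz over ordered adjacent pairs turns the form in `y` into the density for the
  -- weights `y ^ 2`.
  have hcs := Finset.sum_mul_sq_le_sq_mul_sq (Finset.univ ×ˢ Finset.univ)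
    (fun z : V × V => adjInd G z.1 z.2) (fun z : V × V => adjInd G z.1 z.2 * (y z.1 * y z.2))
  simp only [Finset.sum_product, mul_pow, adjInd_sq, ← mul_assoc, ← pow_two] at hcs
  have hm0 : 0 ≤ 2 * m := hm ▸ Finset.sum_nonneg fun a _ => Finset.sum_nonneg fun b _ =>
    adjInd_nonneg ..
  rw [hm] at hcs
  calc _ = (∑ a, ∑ b, adjInd G a b * y a * y b) ^ 2 := by simp only [mul_assoc]
    _ ≤ _ := hcs
    _ = 2 * m * ∑ a, y a ^ 2 * ∑ b, adjInd G a b * y b ^ 2 := by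
        congr 1
        refine Finset.sum_congr rfl fun a _ => ?_
        rw [Finset.mul_sum]
        exact Finset.sum_congr rfl fun b _ => by ring
    _ ≤ _ := mul_le_mul_of_nonneg_left hq' hm0

end K33free

/-! ### Edges between a bounded set and its complement. -/

section Bipartite

theorem sum_le_add_of_card_le_two {V : Type*} {x : V → ℝ} {u v : V}
    (hx : ∀ a, 0 ≤ x a) (hu : ∀ a, x a ≤ x u) (hv : ∀ a, a ≠ u → x a ≤ x v) (s : Finset V)
    (hs : s.card ≤ 2) : ∑ b ∈ s, x b ≤ x u + x v := by
  classical
  have h0 := hx u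
  have h1 := hx v
  interval_cases h : s.card
  · rw [Finset.card_eq_zero.1 h]; simp; positivity
  · obtain ⟨a, rfl⟩ := Finset.card_eq_one.1 h
    rw [Finset.sum_singleton]; linarith [hu a]
  · obtain ⟨a, b, hab, rfl⟩ := Finset.card_eq_two.1 h
    rw [Finset.sum_pair hab]
    by_cases ha : a = u
    · have := hv b fun hb => hab (ha.trans hb.symm)
      linarith [hu a]
    · linarith [hv a ha, hu b]

variable {V : Type*} [Fintype V] {G : SimpleGraph V}

open Classical in
/-- At most `2 |B|³` vertices have three neighbours in `B`. -/
theorem card_three_neighbors_le (hG : ¬ HasK33 G) (B : Finset V) :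
    (Finset.univ.filter fun w => 3 ≤ (B.filter fun b => G.Adj w b).card).card ≤ 2 * B.card ^ 3 := by
  set T := (B ×ˢ B ×ˢ B).filter fun z => z.1 ≠ z.2.1 ∧ z.1 ≠ z.2.2 ∧ z.2.1 ≠ z.2.2 with hT
  have hsub : (Finset.univ.filter fun w => 3 ≤ (B.filter fun b => G.Adj w b).card) ⊆
      T.biUnion fun z => Finset.univ.filter fun a => G.Adj a z.1 ∧ G.Adj a z.2.1 ∧ G.Adj a z.2.2 := by
    intro w hw
    obtain ⟨b, c, d, hb, hc, hd, hbc, hbd, hcd⟩ :=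
      Finset.two_lt_card_iff.1 (show 2 < _ from (Finset.mem_filter.1 hw).2)
    rw [Finset.mem_filter] at hb hc hd
    simp only [Finset.mem_biUnion, Finset.mem_filter, Finset.mem_univ, true_and]
    refine ⟨(b, c, d), ?_, hb.2, hc.2, hd.2⟩
    rw [hT, Finset.mem_filter]
    exact ⟨by simp [hb.1, hc.1, hd.1], hbc, hbd, hcd⟩
  refine (Finset.card_le_card hsub).trans ((Finset.card_biUnion_le_card_mul _ _ 2 ?_).trans ?_)
  · intro z hz
    have := (Finset.mem_filter.1 hz).2
    exact card_common_le_two hG this.1 this.2.1 this.2.2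
  · have : T.card ≤ B.card ^ 3 := by
      refine (Finset.card_filter_le _ _).trans (le_of_eq ?_)
      simp only [Finset.card_product]; ring
    omega

/-- Weight of the edges between a set `B` and its complement. -/
theorem cut_form_le (hG : ¬ HasK33 G) {x : V → ℝ} {u v : V} {m : ℝ}
    (hx : ∀ a, 0 ≤ x a) (hu : ∀ a, x a ≤ x u) (hv : ∀ a, a ≠ u → x a ≤ x v)
    (hsum : ∑ a, x a ^ 2 = 1) (hm : ∑ a, ∑ b, adjInd G a b = 2 * m) (B : Finset V)
    [DecidableEq V] :
    ∑ w ∈ Bᶜ, ∑ b ∈ B, adjInd G w b * (x w * x b) ≤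
      2 * (B.card : ℝ) ^ 4 +
        √m * √((1 - ∑ b ∈ B, x b ^ 2) * (x u ^ 2 + x v ^ 2)) := by
  classical
  have hx1 : ∀ a, x a ≤ 1 := fun a => by
    have := Finset.single_le_sum (f := fun a => x a ^ 2) (fun a _ => sq_nonneg (x a))
      (Finset.mem_univ a)
    rw [hsum] at this
    exact (sq_le_one_iff₀ (hx a)).1 this
  -- The few vertices with three neighbours in `B` are bounded trivially. Any other vertex sees at
  -- most two of `B`, with squared entries summing to at most `x u ^ 2 + x v ^ 2`, which suits
  -- Cauchy–Schwarz.
  set bad := Finset.univ.filter fun w => 3 ≤ (B.filter fun b => G.Adj w b).card with hbad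
  have hcompl : ∑ b ∈ Bᶜ, x b ^ 2 = 1 - ∑ b ∈ B, x b ^ 2 := by
    rw [← hsum, ← Finset.sum_add_sum_compl B]; ring
  have hnn : ∀ w b, 0 ≤ adjInd G w b * (x w * x b) := fun w b =>
    mul_nonneg (adjInd_nonneg ..) (mul_nonneg (hx w) (hx b))
  have hle1 : ∀ w b, adjInd G w b * (x w * x b) ≤ 1 := fun w b =>
    mul_le_one₀ (adjInd_le_one ..) (mul_nonneg (hx w) (hx b))
      (mul_le_one₀ (hx1 w) (hx b) (hx1 b))
  rw [← Finset.sum_filter_add_sum_filter_not Bᶜ (fun w => w ∈ bad)]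
  refine add_le_add ?_ ?_
  · calc ∑ w ∈ Bᶜ with w ∈ bad, ∑ b ∈ B, adjInd G w b * (x w * x b)
        ≤ ∑ w ∈ bad, ∑ b ∈ B, adjInd G w b * (x w * x b) :=
          Finset.sum_le_sum_of_subset_of_nonneg
            (fun w hw => (Finset.mem_filter.1 hw).2)
            fun w _ _ => Finset.sum_nonneg fun b _ => hnn w b
      _ ≤ ∑ w ∈ bad, ∑ b ∈ B, (1 : ℝ) :=
          Finset.sum_le_sum fun w _ => Finset.sum_le_sum fun b _ => hle1 w b
      _ = bad.card * B.card := by simp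
      _ ≤ (2 * B.card ^ 3 : ℕ) * B.card := by
          gcongr
          exact card_three_neighbors_le hG B
      _ = 2 * (B.card : ℝ) ^ 4 := by push_cast; ring
  · set good := Finset.filter (fun w => w ∉ bad) Bᶜ with hgood
    rw [← Real.sqrt_mul' _ (mul_nonneg (hcompl ▸ Finset.sum_nonneg fun b _ => sq_nonneg _)
      (by positivity))]
    refine Real.le_sqrt_of_sq_le ?_
    have hcs := Finset.sum_mul_sq_le_sq_mul_sq (good ×ˢ B)
      (fun z : V × V => adjInd G z.1 z.2) (fun z : V × V => adjInd G z.1 z.2 * (x z.1 * x z.2))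
    simp only [Finset.sum_product, mul_pow, adjInd_sq, ← mul_assoc, ← pow_two] at hcs
    refine le_trans (le_of_eq (by simp only [← mul_assoc])) (hcs.trans (mul_le_mul ?_ ?_ ?_ ?_))
    · have h1 : ∑ w ∈ good, ∑ b ∈ B, adjInd G w b ≤ ∑ w ∈ Bᶜ, ∑ b ∈ B, adjInd G w b :=
        Finset.sum_le_sum_of_subset_of_nonneg (Finset.filter_subset _ _)
          fun w _ _ => Finset.sum_nonneg fun b _ => adjInd_nonneg ..
      have h2 : ∑ w ∈ B, ∑ b ∈ Bᶜ, adjInd G w b = ∑ w ∈ Bᶜ, ∑ b ∈ B, adjInd G w b := by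
        rw [Finset.sum_comm]
        simp only [adjInd_comm G]
      have h3 : ∑ w ∈ B, ∑ b ∈ Bᶜ, adjInd G w b ≤ ∑ w ∈ B, ∑ b, adjInd G w b :=
        Finset.sum_le_sum fun w _ => Finset.sum_le_sum_of_subset_of_nonneg (Finset.subset_univ _)
          fun b _ _ => adjInd_nonneg ..
      have h4 : ∑ w ∈ Bᶜ, ∑ b ∈ B, adjInd G w b ≤ ∑ w ∈ Bᶜ, ∑ b, adjInd G w b :=
        Finset.sum_le_sum fun w _ => Finset.sum_le_sum_of_subset_of_nonneg (Finset.subset_univ _)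
          fun b _ _ => adjInd_nonneg ..
      have h5 := Finset.sum_add_sum_compl B fun w => ∑ b, adjInd G w b
      linarith
    · calc ∑ w ∈ good, ∑ b ∈ B, adjInd G w b * x w ^ 2 * x b ^ 2
          = ∑ w ∈ good, x w ^ 2 * ∑ b ∈ B with G.Adj w b, x b ^ 2 := by
            refine Finset.sum_congr rfl fun w _ => ?_
            rw [Finset.sum_filter, Finset.mul_sum]
            refine Finset.sum_congr rfl fun b _ => ?_
            unfold adjInd
            split_ifs <;> simp
        _ ≤ ∑ w ∈ good, x w ^ 2 * (x u ^ 2 + x v ^ 2) := by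
            refine Finset.sum_le_sum fun w hw => mul_le_mul_of_nonneg_left ?_ (sq_nonneg _)
            refine sum_le_add_of_card_le_two (x := fun a => x a ^ 2)
              (fun a => sq_nonneg _) (fun a => pow_le_pow_left₀ (hx a) (hu a) 2)
              (fun a ha => pow_le_pow_left₀ (hx a) (hv a ha) 2) _ ?_
            have := (Finset.mem_filter.1 hw).2
            simp only [hbad, Finset.mem_filter, Finset.mem_univ, true_and] at this
            omega
        _ = (∑ w ∈ good, x w ^ 2) * (x u ^ 2 + x v ^ 2) := by rw [Finset.sum_mul]
        _ ≤ (1 - ∑ b ∈ B, x b ^ 2) * (x u ^ 2 + x v ^ 2) := by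
            refine mul_le_mul_of_nonneg_right ?_ (by positivity)
            rw [← hcompl]
            exact Finset.sum_le_sum_of_subset_of_nonneg (Finset.filter_subset _ _)
              fun w _ _ => sq_nonneg _
    · exact Finset.sum_nonneg fun w _ => Finset.sum_nonneg fun b _ =>
        mul_nonneg (mul_nonneg (adjInd_nonneg ..) (sq_nonneg _)) (sq_nonneg _)
    · have : 0 ≤ 2 * m := hm ▸ Finset.sum_nonneg fun a _ => Finset.sum_nonneg fun b _ =>
        adjInd_nonneg ..
      linarith

end Bipartite

/-! ### All entries beyond the two largest are small. -/

section Third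

variable {V : Type*} [Fintype V] {G : SimpleGraph V}

/-- A bound for the number of vertices with a large entry in a unit vector. -/
def heavyBound : ℝ := 5 * (5 * 10 ^ 7) ^ 3

theorem third_entry_le_of_unit (hG : ¬ HasK33 G) {x : V → ℝ} {u v w : V} {m ρ : ℝ}
    (huv : u ≠ v) (hwu : w ≠ u) (hwv : w ≠ v)
    (hx : ∀ a, 0 ≤ x a) (hu : ∀ a, x a ≤ x u) (hv : ∀ a, a ≠ u → x a ≤ x v)
    (hsum : ∑ a, x a ^ 2 = 1) (hm : ∑ a, ∑ b, adjInd G a b = 2 * m)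
    (heig : ∀ a, ∑ b, adjInd G a b * x b = ρ * x a) (hρ : √m ≤ ρ)
    (hM : 5000 * (heavyBound + 4 * heavyBound ^ 4) ≤ √m) :
    10 * x w ≤ x u := by
  classical
  have hN1 : (1 : ℝ) ≤ heavyBound := by norm_num [heavyBound]
  have hx1 : ∀ a, x a ≤ 1 := fun a => by
    have := Finset.single_le_sum (f := fun a => x a ^ 2) (fun a _ => sq_nonneg (x a))
      (Finset.mem_univ a)
    rw [hsum] at this
    exact (sq_le_one_iff₀ (hx a)).1 this
  set B := Finset.univ.filter fun a => 1 ≤ heavyBound * x a ^ 2 with hB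
  have hBcard : (B.card : ℝ) ≤ heavyBound := by
    calc (B.card : ℝ) = ∑ a ∈ B, (1 : ℝ) := by simp
      _ ≤ ∑ a ∈ B, heavyBound * x a ^ 2 :=
          Finset.sum_le_sum fun a ha => (Finset.mem_filter.1 ha).2
      _ ≤ ∑ a, heavyBound * x a ^ 2 := Finset.sum_le_sum_of_subset_of_nonneg
          (Finset.subset_univ _) fun a _ _ => by positivity
      _ = heavyBound := by rw [← Finset.mul_sum, hsum, mul_one]
  have hcut := cut_form_le hG hx hu hv hsum hm B
  set F : V → V → ℝ := fun a b => adjInd G a b * (x a * x b) with hF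
  have htotal : ∑ a, ∑ b, F a b = ρ := by
    calc ∑ a, ∑ b, F a b = ∑ a, x a * ∑ b, adjInd G a b * x b := by
          refine Finset.sum_congr rfl fun a _ => ?_
          rw [Finset.mul_sum]
          exact Finset.sum_congr rfl fun b _ => by simp only [hF]; ring
      _ = ∑ a, ρ * x a ^ 2 := Finset.sum_congr rfl fun a _ => by rw [heig]; ring
      _ = ρ := by rw [← Finset.mul_sum, hsum, mul_one]
  have hsplit : ∑ a, ∑ b, F a b = ∑ a ∈ B, ∑ b ∈ B, F a b + 2 * ∑ a ∈ Bᶜ, ∑ b ∈ B, F a b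
      + ∑ a ∈ Bᶜ, ∑ b ∈ Bᶜ, F a b := by
    have hc : ∑ a ∈ B, ∑ b ∈ Bᶜ, F a b = ∑ a ∈ Bᶜ, ∑ b ∈ B, F a b := by
      rw [Finset.sum_comm]
      refine Finset.sum_congr rfl fun a _ => Finset.sum_congr rfl fun b _ => ?_
      simp only [hF, adjInd_comm G b a, mul_comm (x b)]
    rw [← Finset.sum_add_sum_compl B]
    simp_rw [← Finset.sum_add_sum_compl B (fun b => F _ b), Finset.sum_add_distrib]
    rw [hc]; ring
  have hBB : ∑ a ∈ B, ∑ b ∈ B, F a b ≤ B.card := by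
    calc ∑ a ∈ B, ∑ b ∈ B, F a b ≤ ∑ a ∈ B, ∑ b ∈ B, x a * x b :=
          Finset.sum_le_sum fun a _ => Finset.sum_le_sum fun b _ =>
            mul_le_of_le_one_left (mul_nonneg (hx a) (hx b)) (adjInd_le_one ..)
      _ = (∑ a ∈ B, x a) ^ 2 := by rw [pow_two, Finset.sum_mul_sum]
      _ ≤ B.card * ∑ a ∈ B, x a ^ 2 := sq_sum_le_card_mul_sum_sq
      _ ≤ B.card * 1 := by
          gcongr
          rw [← hsum]
          exact Finset.sum_le_sum_of_subset_of_nonneg (Finset.subset_univ _)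
            fun a _ _ => sq_nonneg _
      _ = B.card := mul_one _
  have hm0 : 0 ≤ m := by
    have : 0 ≤ 2 * m := hm ▸ Finset.sum_nonneg fun a _ => Finset.sum_nonneg fun b _ =>
      adjInd_nonneg ..
    linarith
  -- Light entries satisfy `5 * x a ^ 2 ≤ τ ^ 3` with $\tau=1/(5\cdot10^7)$, chosen so that
  -- $2\tau=(1/5000)^2$.
  have hLL : ∑ a ∈ Bᶜ, ∑ b ∈ Bᶜ, F a b ≤ √m / 5000 := by
    set y : V → ℝ := fun a => if a ∈ B then 0 else x a with hy
    have e : ∑ a, ∑ b, adjInd G a b * (y a * y b) = ∑ a ∈ Bᶜ, ∑ b ∈ Bᶜ, F a b := by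
      rw [← Finset.sum_add_sum_compl B, Finset.sum_eq_zero, zero_add]
      · refine Finset.sum_congr rfl fun a ha => ?_
        rw [← Finset.sum_add_sum_compl B, Finset.sum_eq_zero, zero_add]
        · refine Finset.sum_congr rfl fun b hb => ?_
          simp only [hy, hF, if_neg (Finset.mem_compl.1 ha), if_neg (Finset.mem_compl.1 hb)]
        · intro b hb
          simp [hy, hb]
      · intro a ha
        exact Finset.sum_eq_zero fun b _ => by simp [hy, ha]
    have hq := quadratic_form_sq_le hG (y := y) (τ := 1 / (5 * 10 ^ 7)) (m := m) (by norm_num)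
      (fun a => ?_) ?_ hm
    · rw [e] at hq
      refine le_trans (Real.le_sqrt_of_sq_le hq) (le_of_eq ?_)
      rw [show 2 * m * (1 / (5 * 10 ^ 7)) = m * (1 / 5000) ^ 2 by ring, Real.sqrt_mul hm0,
        Real.sqrt_sq (by norm_num)]
      ring
    · by_cases ha : a ∈ B
      · simp [hy, ha]
      · have : ¬ 1 ≤ heavyBound * x a ^ 2 := fun h => ha (Finset.mem_filter.2 ⟨Finset.mem_univ _, h⟩)
        simp only [hy, if_neg ha]
        rw [heavyBound] at this
        norm_num at this ⊢
        linarith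
    · rw [← hsum]
      refine Finset.sum_le_sum fun a _ => ?_
      simp only [hy]
      split_ifs
      · simpa using sq_nonneg (x a)
      · exact le_rfl
  set β := ∑ b ∈ B, x b ^ 2 with hβ
  set s := √((1 - β) * (x u ^ 2 + x v ^ 2)) with hs
  have hB4 : (B.card : ℝ) ^ 4 ≤ heavyBound ^ 4 := by gcongr
  have hmpos : 0 < √m := lt_of_lt_of_le (by positivity) hM
  -- The edges inside `B` together with the trivial part of the cut, and the light edges, each take
  -- at most `√m / 5000` out of `ρ ≥ √m`.
  have hs2 : 0.4998 ≤ s := by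
    have : √m * 0.4998 ≤ √m * s := by linarith
    exact le_of_mul_le_mul_left this hmpos
  have hβ0 : 0 ≤ β := Finset.sum_nonneg fun b _ => sq_nonneg _
  have hprod : 0.2498 ≤ (1 - β) * (x u ^ 2 + x v ^ 2) := by
    by_contra! h
    have : s ^ 2 ≤ 0.2498 := by
      rcases le_total 0 ((1 - β) * (x u ^ 2 + x v ^ 2)) with h0 | h0
      · rw [hs, Real.sq_sqrt h0]; exact h.le
      · rw [hs, Real.sqrt_eq_zero_of_nonpos h0]; norm_num
    nlinarith
  have hPpos : 0.2498 ≤ x u ^ 2 + x v ^ 2 := by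
    nlinarith [mul_nonneg hβ0 (add_nonneg (sq_nonneg (x u)) (sq_nonneg (x v)))]
  have hvu : x v ^ 2 ≤ x u ^ 2 := pow_le_pow_left₀ (hx v) (hu v) 2
  have hwle : x w ^ 2 ≤ x v ^ 2 := pow_le_pow_left₀ (hx w) (hv w hwu) 2
  -- If `w` is heavy then `u`, `v`, `w` all count in `β`, and $P(1-P)\le 1/4$ leaves no more than
  -- 0.0002 for `x w ^ 2 * P`. A light entry is tiny already, and $x_u^2\ge P/2$.
  have key : (10 * x w) ^ 2 ≤ x u ^ 2 := by
    by_cases hw : 1 ≤ heavyBound * x w ^ 2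
    · have hmem : ∀ a, x w ^ 2 ≤ x a ^ 2 → a ∈ B := fun a ha =>
        Finset.mem_filter.2 ⟨Finset.mem_univ _, hw.trans (by gcongr)⟩
      have h3 : x u ^ 2 + x v ^ 2 + x w ^ 2 ≤ β := by
        have hsub : ({u, v, w} : Finset V) ⊆ B := by
          intro a ha
          simp only [Finset.mem_insert, Finset.mem_singleton] at ha
          rcases ha with rfl | rfl | rfl
          · exact hmem _ (hwle.trans hvu)
          · exact hmem _ hwle
          · exact hmem _ le_rfl
        calc _ = ∑ a ∈ ({u, v, w} : Finset V), x a ^ 2 := by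
              rw [Finset.sum_insert, Finset.sum_insert, Finset.sum_singleton]
              · ring
              · simpa using hwv.symm
              · simp [huv, hwu.symm]
          _ ≤ β := Finset.sum_le_sum_of_subset_of_nonneg hsub fun a _ _ => sq_nonneg _
      set P := x u ^ 2 + x v ^ 2
      have h4 : 0.2498 ≤ (1 - P - x w ^ 2) * P := hprod.trans (by nlinarith)
      have h5 : x w ^ 2 * P ≤ 0.0002 := by nlinarith [sq_nonneg (P - 1 / 2)]
      have h6 : x w ^ 2 * 0.2498 ≤ 0.0002 := le_trans (by nlinarith [sq_nonneg (x w)]) h5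
      nlinarith
    · have : x w ^ 2 ≤ 0.001 := by
        rw [heavyBound] at hw
        norm_num at hw ⊢
        linarith
      nlinarith
  exact (pow_le_pow_iff_left₀ (by have := hx w; positivity) (hx u) two_ne_zero).1 key

theorem third_entry_le (hG : ¬ HasK33 G) {x : V → ℝ} {u v w : V} {m ρ : ℝ}
    (huv : u ≠ v) (hwu : w ≠ u) (hwv : w ≠ v)
    (hx : ∀ a, 0 ≤ x a) (hu : ∀ a, x a ≤ x u) (hv : ∀ a, a ≠ u → x a ≤ x v)
    (hxu : 0 < x u) (hm : ∑ a, ∑ b, adjInd G a b = 2 * m)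
    (heig : ∀ a, ∑ b, adjInd G a b * x b = ρ * x a) (hρ : √m ≤ ρ)
    (hM : 5000 * (heavyBound + 4 * heavyBound ^ 4) ≤ √m) :
    10 * x w ≤ x u := by
  have hS : 0 < ∑ a, x a ^ 2 :=
    Finset.sum_pos' (fun a _ => sq_nonneg _) ⟨u, Finset.mem_univ _, by positivity⟩
  set c := √(∑ a, x a ^ 2) with hc
  have hc0 : 0 < c := Real.sqrt_pos.2 hS
  have := third_entry_le_of_unit hG (x := fun a => x a / c) (m := m) (ρ := ρ) huv hwu hwv
    (fun a => div_nonneg (hx a) hc0.le) (fun a => by gcongr; exact hu a)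
    (fun a ha => by gcongr; exact hv a ha) ?_ hm (fun a => ?_) hρ hM
  · simp only [← mul_div_assoc] at this
    exact (div_le_div_iff_of_pos_right hc0).1 this
  · simp only [div_pow, ← Finset.sum_div]
    rw [hc, Real.sq_sqrt hS.le, div_self hS.ne']
  · simp only [← mul_div_assoc, ← Finset.sum_div]
    rw [heig]

end Third

/-! ### Books with pendant vertices, and rigidity of near-extremal graphs. -/

/-- Adjacency between the classes of a book with pendant edges: class `0` is the first spine vertex,
`1` the second one, `2` the common neighbours, `3` the pendant vertices at the first one. -/
def bookRel (x y : Fin 4) : Prop := x = 0 ∨ y = 0 ∨ (x = 1 ∧ y = 2) ∨ (x = 2 ∧ y = 1)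

instance : DecidableRel bookRel := fun x y => by unfold bookRel; infer_instance

/-- `G` consists of two adjacent vertices with `c` common neighbours, and `i` pendant vertices
attached to the first of them. -/
def IsBook {V : Type*} (G : SimpleGraph V) (c i : ℕ) : Prop :=
  ∃ f : V → Fin 4, (∀ a b, G.Adj a b ↔ a ≠ b ∧ bookRel (f a) (f b)) ∧
    ∀ k, Nat.card {a // f a = k} = ![1, 1, c, i] k

section Extremal

variable {V : Type*} [Fintype V] {G : SimpleGraph V}

theorem sum_eq_add_add_sum_compl [DecidableEq V] {u v : V} (huv : u ≠ v) (f : V → ℝ) :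
    ∑ a, f a = f u + f v + ∑ a ∈ ({u, v} : Finset V)ᶜ, f a := by
  rw [← Finset.sum_add_sum_compl {u, v}, Finset.sum_pair huv]

theorem edge_count_split [DecidableEq V] {u v : V} (huv : u ≠ v) :
    ∑ a, ∑ b, adjInd G a b = 2 * adjInd G u v
      + 2 * ∑ y ∈ ({u, v} : Finset V)ᶜ, adjInd G u y
      + 2 * ∑ y ∈ ({u, v} : Finset V)ᶜ, adjInd G v y
      + ∑ y ∈ ({u, v} : Finset V)ᶜ, ∑ w ∈ ({u, v} : Finset V)ᶜ, adjInd G y w := by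
  have huu : ∀ a, adjInd G a a = 0 := fun a => by simp [adjInd]
  rw [sum_eq_add_add_sum_compl huv]
  simp_rw [fun a => sum_eq_add_add_sum_compl huv (adjInd G a)]
  rw [Finset.sum_add_distrib, Finset.sum_add_distrib, huu, huu, adjInd_comm G v u]
  simp_rw [adjInd_comm G _ u, adjInd_comm G _ v]
  rw [adjInd_comm G v u]
  ring

/-- Expands $\rho^2x_u$ along walks of length two from `u`, keeping the branch through `v` as `ρ * x
v`. -/
theorem two_walk_le [DecidableEq V] {u v : V} (huv : u ≠ v) {x : V → ℝ} {ρ ε : ℝ}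
    (hx : ∀ a, 0 ≤ x a) (hxu : x u = 1) (hε : ∀ w, w ≠ u → w ≠ v → x w ≤ ε)
    (heig : ∀ a, ∑ b, adjInd G a b * x b = ρ * x a) :
    ρ ^ 2 ≤ ρ * x v * adjInd G u v + ∑ y ∈ ({u, v} : Finset V)ᶜ, adjInd G u y
      + x v * ∑ y ∈ ({u, v} : Finset V)ᶜ, adjInd G u y * adjInd G v y
      + ε * ∑ y ∈ ({u, v} : Finset V)ᶜ, ∑ w ∈ ({u, v} : Finset V)ᶜ, adjInd G y w := by
  set S := ({u, v} : Finset V)ᶜ with hS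
  have huu : adjInd G u u = 0 := by simp [adjInd]
  have e1 : ρ ^ 2 = ∑ y, adjInd G u y * (ρ * x y) := by
    have := heig u
    rw [hxu, mul_one] at this
    rw [pow_two]
    nth_rewrite 2 [← this]
    rw [Finset.mul_sum]
    exact Finset.sum_congr rfl fun y _ => by ring
  have e2 : ∀ y ∈ S, adjInd G u y * (ρ * x y) ≤ adjInd G u y
      + x v * (adjInd G u y * adjInd G v y) + ε * ∑ w ∈ S, adjInd G y w := by
    intro y hy
    rw [← heig, sum_eq_add_add_sum_compl huv, hxu, mul_one, ← hS, adjInd_comm G y u,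
      adjInd_comm G y v, mul_add, mul_add, ← pow_two, adjInd_sq]
    have h1 : ∑ w ∈ S, adjInd G y w * x w ≤ ε * ∑ w ∈ S, adjInd G y w := by
      rw [Finset.mul_sum]
      refine Finset.sum_le_sum fun w hw => ?_
      simp only [hS, Finset.mem_compl, Finset.mem_insert, Finset.mem_singleton, not_or] at hw
      rw [mul_comm]
      exact mul_le_mul_of_nonneg_right (hε w hw.1 hw.2) (adjInd_nonneg ..)
    have h2 : adjInd G u y * ∑ w ∈ S, adjInd G y w * x w ≤ ∑ w ∈ S, adjInd G y w * x w :=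
      mul_le_of_le_one_left (Finset.sum_nonneg fun w _ => mul_nonneg (adjInd_nonneg ..) (hx w))
        (adjInd_le_one ..)
    linarith
  rw [e1, sum_eq_add_add_sum_compl huv, huu, ← hS]
  have := Finset.sum_le_sum e2
  rw [Finset.sum_add_distrib, Finset.sum_add_distrib, ← Finset.mul_sum, ← Finset.mul_sum] at this
  linarith

/-- The numerical core for a book with `c` common neighbours and `i` pendant vertices. -/
theorem pendant_lt_three {ρ y c i : ℝ} (hρ : 10 ≤ ρ) (hc : 0 ≤ c) (hi : 0 ≤ i)
    (h1 : 2 * c + i - 0.6 ≤ ρ ^ 2 - ρ) (h2 : ρ ^ 2 ≤ ρ * y + (c + i) + y * c)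
    (h3 : (1 - y) * (ρ * (ρ + 1)) = i) : i < 3 := by
  by_contra! hi3
  set Q := ρ * (ρ + 1) with hQ
  have hQ0 : 0 < Q := by positivity
  -- `h1` against `h2`. Since $c+\rho$ is at least $Q/4$ by `h6` and `h7`, and $(1-y)Q=i$, this
  -- forces $i\le 2.4$.
  have hloss : (c + ρ) * (1 - y) ≤ 0.6 := by nlinarith
  have h4 : (c + ρ) * i ≤ 0.6 * Q := by
    rw [← h3]; nlinarith
  have h5 : i ≤ 0.6 * (ρ + 1) := by
    have : ρ * i ≤ ρ * (0.6 * (ρ + 1)) := by nlinarith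
    exact le_of_mul_le_mul_left this (by linarith)
  have hy : 0 ≤ 1 - y := by
    by_contra! h
    nlinarith
  have h6 : ρ ^ 2 + ρ - i ≤ 2 * (c + ρ) := by nlinarith
  have h7 : 0.5 * Q ≤ ρ ^ 2 + ρ - i := by nlinarith
  nlinarith

/-- Without the slack 0.6 the same comparison forces `y = 1`. -/
theorem pendant_eq_zero {ρ y c i : ℝ} (hρ : 0 < ρ) (hc : 0 ≤ c) (hy : y ≤ 1)
    (h1 : 2 * c + i ≤ ρ ^ 2 - ρ) (h2 : ρ ^ 2 ≤ ρ * y + (c + i) + y * c)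
    (h3 : (1 - y) * (ρ * (ρ + 1)) = i) : i = 0 := by
  have hloss : (c + ρ) * (1 - y) ≤ 0 := by nlinarith
  have : 1 - y ≤ 0 := by
    by_contra! h
    nlinarith
  rw [← h3, show 1 - y = 0 by linarith, zero_mul]

theorem nat_card_fiber {V : Type*} (g : V → Fin 4) (k : Fin 4) (T : Finset V) (h : ∀ y, g y = k ↔ y ∈ T) :
    Nat.card {y // g y = k} = T.card := by
  rw [Nat.card_congr (Equiv.subtypeEquivRight h), Nat.card_eq_fintype_card, Fintype.card_coe]

open Classical in
theorem isBook_of_spine {u v : V} (huv : u ≠ v) (huvA : G.Adj u v)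
    (hall : ∀ y, y ≠ u → y ≠ v → G.Adj u y)
    (hSS : ∀ y w, y ≠ u → y ≠ v → w ≠ u → w ≠ v → ¬ G.Adj y w) :
    IsBook G ((({u, v} : Finset V)ᶜ).filter fun y => G.Adj v y).card
      ((({u, v} : Finset V)ᶜ).filter fun y => ¬ G.Adj v y).card := by
  refine ⟨fun y => if y = u then 0 else if y = v then 1 else if G.Adj v y then 2 else 3, ?_, ?_⟩
  · intro y w
    by_cases hyu : y = u
    · subst hyu
      simp only [if_true, bookRel, true_or, and_true]
      by_cases hwv : w = v
      · subst hwv; simp [huvA, huv]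
      · exact ⟨fun h => h.ne, fun h => hall w h.symm hwv⟩
    by_cases hwu : w = u
    · subst hwu
      simp only [if_true, bookRel, true_or, or_true, and_true]
      by_cases hyv : y = v
      · subst hyv; simp [huvA.symm, huv.symm]
      · exact ⟨fun h => h.ne, fun h => (hall y h hyv).symm⟩
    by_cases hyv : y = v
    · subst hyv
      by_cases hwv : w = y
      · subst hwv; simp
      · by_cases h : G.Adj y w <;> simp [hyu, hwu, hwv, h, bookRel, Ne.symm hwv]
    by_cases hwv : w = v
    · subst hwv
      rw [G.adj_comm]
      by_cases h : G.Adj w y <;> simp [hyu, hwu, hyv, h, bookRel]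
    simp only [hyu, hwu, hyv, hwv, if_false]
    have := hSS y w hyu hyv hwu hwv
    split_ifs <;> simp [bookRel, this]
  · intro k
    fin_cases k
    · refine (nat_card_fiber _ _ {u} fun y => ?_).trans (by simp)
      by_cases h1 : y = u <;> by_cases h2 : y = v <;> by_cases h3 : G.Adj v y <;>
        simp [h1, h2, h3]
    · refine (nat_card_fiber _ _ {v} fun y => ?_).trans (by simp)
      by_cases h1 : y = u
      · simp [h1, huv]
      by_cases h2 : y = v <;> by_cases h3 : G.Adj v y <;> simp [h1, h2, h3, huv.symm]
    · refine nat_card_fiber _ _ _ fun y => ?_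
      by_cases h1 : y = u
      · simp [h1]
      by_cases h2 : y = v
      · simp [h2, huv.symm]
      by_cases h3 : G.Adj v y <;> simp [h1, h2, h3]
    · refine nat_card_fiber _ _ _ fun y => ?_
      by_cases h1 : y = u
      · simp [h1]
      by_cases h2 : y = v
      · simp [h2, huv.symm]
      by_cases h3 : G.Adj v y <;> simp [h1, h2, h3]

/-- With $a,b,c$ the numbers of further neighbours of `u`, of `v` and of both, and $r$ the ordered
adjacent pairs off the spine, $m=[uv]+a+b+r/2$ is compared with the bound of `two_walk_le`. Every
deviation from a book pushes $\rho^2-\rho$ below $m-1.6$. -/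
theorem isBook_of_entries_le (hiso : ∀ v, ¬ G.IsIsolated v) {x : V → ℝ} {ρ : ℝ} {m : ℕ} {u v : V}
    (huv : u ≠ v) (hx : ∀ a, 0 ≤ x a) (hxu : x u = 1) (hxv : x v ≤ 1)
    (hε : ∀ w, w ≠ u → w ≠ v → x w ≤ 1 / 10)
    (heig : ∀ a, ∑ b, adjInd G a b * x b = ρ * x a)
    (hm : ∑ a, ∑ b, adjInd G a b = 2 * m) (hρ : 10 ≤ ρ)
    (hρm : (m : ℝ) - 1.6 ≤ ρ ^ 2 - ρ) (hodd : Odd m → (m : ℝ) - 1 ≤ ρ ^ 2 - ρ) :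
    ∃ c i, IsBook G c i ∧ m = 2 * c + 1 + i ∧ (Odd m → i = 0) ∧ (¬ Odd m → i = 1) := by
  classical
  have hwalk := two_walk_le huv hx hxu hε heig
  have hcount := edge_count_split (G := G) huv
  rw [hm] at hcount
  set S := ({u, v} : Finset V)ᶜ with hS
  have memS : ∀ y, y ∈ S ↔ y ≠ u ∧ y ≠ v := fun y => by simp [hS]
  set a := ∑ y ∈ S, adjInd G u y with ha
  set b := ∑ y ∈ S, adjInd G v y with hb
  set c := ∑ y ∈ S, adjInd G u y * adjInd G v y with hc
  set r := ∑ y ∈ S, ∑ w ∈ S, adjInd G y w with hr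
  have hv0 := hx v
  have ha0 : 0 ≤ a := Finset.sum_nonneg fun y _ => adjInd_nonneg ..
  have hc0 : 0 ≤ c := Finset.sum_nonneg fun y _ => mul_nonneg (adjInd_nonneg ..) (adjInd_nonneg ..)
  have hr0 : 0 ≤ r := Finset.sum_nonneg fun y _ => Finset.sum_nonneg fun w _ => adjInd_nonneg ..
  have hbc : b - c = ∑ y ∈ S, adjInd G v y * (1 - adjInd G u y) := by
    rw [hb, hc, ← Finset.sum_sub_distrib]
    exact Finset.sum_congr rfl fun y _ => by ring
  have hbc0 : ∀ y ∈ S, 0 ≤ adjInd G v y * (1 - adjInd G u y) := fun y _ =>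
    mul_nonneg (adjInd_nonneg ..) (sub_nonneg.2 (adjInd_le_one ..))
  have hcb : 0 ≤ b - c := hbc ▸ Finset.sum_nonneg hbc0
  have hcv : x v * c ≤ c := mul_le_of_le_one_left hc0 hxv
  have huvA : G.Adj u v := by
    by_contra h
    have h0 : adjInd G u v = 0 := by simp [adjInd, h]
    rw [h0] at hwalk hcount
    linarith
  have h1 : adjInd G u v = 1 := by simp [adjInd, huvA]
  rw [h1] at hwalk hcount
  -- An edge off the spine has `r ≥ 2` and loses $r/2-r/10\ge0.8$, giving at most $m-1.8$.
  have hSS : ∀ y ∈ S, ∀ w ∈ S, ¬ G.Adj y w := by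
    intro y hy w hw hyw
    have h2 : 2 ≤ r := by
      have e : ∑ z ∈ ({(y, w), (w, y)} : Finset (V × V)), adjInd G z.1 z.2 = 2 := by
        rw [Finset.sum_pair (by simp [hyw.ne])]
        simp only [adjInd, if_pos hyw, if_pos hyw.symm]; norm_num
      rw [← e, hr, ← Finset.sum_product']
      refine Finset.sum_le_sum_of_subset_of_nonneg ?_ fun z _ _ => adjInd_nonneg ..
      intro z hz
      simp only [Finset.mem_insert, Finset.mem_singleton] at hz
      rcases hz with rfl | rfl <;> simp [hy, hw]
    nlinarith
  have hr00 : r = 0 := Finset.sum_eq_zero fun y hy => Finset.sum_eq_zero fun w hw => by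
    simp [adjInd, hSS y hy w hw]
  rw [hr00] at hwalk hcount
  -- A neighbour of `v` alone is counted in `m` but not in the walk bound, a loss of 1.
  have hsub : ∀ y ∈ S, G.Adj v y → G.Adj u y := by
    intro y hy hvy
    by_contra huy
    have h2 : 1 ≤ b - c := by
      rw [hbc]
      refine le_trans ?_ (Finset.single_le_sum hbc0 hy)
      simp [adjInd, hvy, huy]
    nlinarith
  have hall : ∀ y ∈ S, G.Adj u y := by
    intro y hy
    by_contra huy
    refine hiso y fun w hyw => ?_
    by_cases hwu : w = u
    · exact huy (hwu ▸ hyw.symm)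
    by_cases hwv : w = v
    · exact huy (hsub y hy (hwv ▸ hyw.symm))
    exact hSS y hy w ((memS w).2 ⟨hwu, hwv⟩) hyw
  set C := S.filter fun y => G.Adj v y with hC
  set P := S.filter fun y => ¬ G.Adj v y with hP
  have hAu : ∀ y ∈ S, adjInd G u y = 1 := fun y hy => by simp [adjInd, hall y hy]
  have hbC : b = C.card := by
    simp only [hb, hC, adjInd, Finset.sum_boole]
  have hcC : c = C.card := by
    rw [← hbC, hc, hb]
    exact Finset.sum_congr rfl fun y hy => by rw [hAu y hy, one_mul]
  have haC : a = C.card + P.card := by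
    rw [ha, Finset.sum_congr rfl hAu, Finset.sum_const, nsmul_eq_mul, mul_one, hC, hP,
      ← Nat.cast_add, Finset.card_filter_add_card_filter_not]
  have hmR : (m : ℝ) = 2 * C.card + 1 + P.card := by
    rw [haC, hbC] at hcount; linarith
  have hmN : m = 2 * C.card + 1 + P.card := by exact_mod_cast hmR
  have eu : ρ = x v + (∑ y ∈ C, x y + ∑ y ∈ P, x y) := by
    have := heig u
    rw [sum_eq_add_add_sum_compl huv, hxu, h1, ← hS,
      Finset.sum_congr rfl fun y hy => by rw [hAu y hy, one_mul]] at this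
    rw [hC, hP, Finset.sum_filter_add_sum_filter_not]
    simp only [adjInd, SimpleGraph.irrefl, if_false] at this
    linarith
  have ev : ρ * x v = 1 + ∑ y ∈ C, x y := by
    rw [← heig, sum_eq_add_add_sum_compl huv, hxu, adjInd_comm, h1, ← hS, hC, Finset.sum_filter]
    simp only [adjInd, SimpleGraph.irrefl, if_false, ite_mul, one_mul, zero_mul, add_zero]
  have eP : ∀ y ∈ P, ρ * x y = 1 := by
    intro y hy
    rw [hP, Finset.mem_filter] at hy
    rw [← heig, sum_eq_add_add_sum_compl huv, hxu, adjInd_comm, hAu y hy.1, ← hS,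
      Finset.sum_eq_zero fun w hw => by simp [adjInd, hSS y hy.1 w hw], adjInd_comm]
    simp [adjInd, hy.2]
  have esum : ρ * ∑ y ∈ P, x y = P.card := by
    rw [Finset.mul_sum, Finset.sum_congr rfl eP]; simp
  -- The difference of the eigenvalue equations at `u` and `v`, in which the common neighbours
  -- cancel.
  have key3 : (1 - x v) * (ρ * (ρ + 1)) = P.card := by
    rw [← esum]
    linear_combination ρ * eu - ρ * ev
  have key2 : ρ ^ 2 ≤ ρ * x v + ((C.card : ℝ) + P.card) + x v * C.card := by
    rw [haC, hcC] at hwalk; linarith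
  refine ⟨C.card, P.card, ?_, hmN, fun ho => ?_, fun ho => ?_⟩
  · exact isBook_of_spine huv huvA (fun y h1 h2 => hall y ((memS y).2 ⟨h1, h2⟩))
      fun y w h1 h2 h3 h4 => hSS y ((memS y).2 ⟨h1, h2⟩) w ((memS w).2 ⟨h3, h4⟩)
  · have := hodd ho
    rw [hmR] at this
    exact_mod_cast pendant_eq_zero (by linarith) (Nat.cast_nonneg _) hxv (by linarith) key2 key3
  -- For even `m` the number of pendant vertices is odd, so below 3 it is 1.
  · rw [hmR] at hρm
    have h3 : (P.card : ℝ) < 3 := pendant_lt_three hρ (Nat.cast_nonneg _) (Nat.cast_nonneg _)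
      (by linarith) key2 key3
    have h3' : P.card < 3 := by exact_mod_cast h3
    rw [Nat.not_odd_iff_even, Nat.even_iff] at ho
    omega

end Extremal

section

variable {V : Type*} [Fintype V] {G : SimpleGraph V}

theorem sum_adjInd_eq_two_mul_ncard (G : SimpleGraph V) :
    ∑ a, ∑ b, adjInd G a b = 2 * (G.edgeSet.ncard : ℝ) := by
  classical
  have h := G.sum_degrees_eq_twice_card_edges
  have h2 : G.edgeSet.ncard = G.edgeFinset.card := by
    rw [← SimpleGraph.coe_edgeFinset, Set.ncard_coe_finset]
  rw [h2]
  have h3 : (2 * G.edgeFinset.card : ℝ) = ∑ a, (G.degree a : ℝ) := by exact_mod_cast h.symm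
  rw [h3]
  refine Finset.sum_congr rfl fun a _ => ?_
  simp only [adjInd, Finset.sum_boole, ← SimpleGraph.card_neighborFinset_eq_degree,
    SimpleGraph.neighborFinset_eq_filter]

theorem isBook_of_eigenvector (hG : ¬ HasK33 G) (hiso : ∀ v, ¬ G.IsIsolated v) {x : V → ℝ} {ρ : ℝ}
    (hx : ∀ a, 0 ≤ x a) (hx0 : ∃ a, x a ≠ 0) (heig : ∀ a, ∑ b, adjInd G a b * x b = ρ * x a)
    (hρ0 : 0 ≤ ρ) {m : ℕ} (hm : ∑ a, ∑ b, adjInd G a b = 2 * m)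
    (hM : 5000 * (heavyBound + 4 * heavyBound ^ 4) ≤ √m)
    (hρm : (m : ℝ) - 1.6 ≤ ρ ^ 2 - ρ) (hodd : Odd m → (m : ℝ) - 1 ≤ ρ ^ 2 - ρ) :
    ∃ c i, IsBook G c i ∧ m = 2 * c + 1 + i ∧ (Odd m → i = 0) ∧ (¬ Odd m → i = 1) := by
  classical
  obtain ⟨a₀, ha₀⟩ := hx0
  obtain ⟨u, -, hu⟩ := Finset.exists_max_image Finset.univ x ⟨a₀, Finset.mem_univ _⟩
  have hu' : ∀ a, x a ≤ x u := fun a => hu a (Finset.mem_univ a)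
  have hxu : 0 < x u := lt_of_lt_of_le (lt_of_le_of_ne (hx a₀) ha₀.symm) (hu' a₀)
  obtain ⟨w₀, hw₀⟩ := not_forall_not.1 (hiso u)
  obtain ⟨v, hvmem, hv⟩ := Finset.exists_max_image (Finset.univ.erase u) x
    ⟨w₀, Finset.mem_erase.2 ⟨hw₀.ne', Finset.mem_univ _⟩⟩
  have huv : u ≠ v := (Finset.ne_of_mem_erase hvmem).symm
  have hv' : ∀ a, a ≠ u → x a ≤ x v := fun a ha =>
    hv a (Finset.mem_erase.2 ⟨ha, Finset.mem_univ _⟩)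
  have hsq : √(m : ℝ) ^ 2 = m := Real.sq_sqrt (Nat.cast_nonneg _)
  have hs : (5000 : ℝ) ≤ √m := le_trans (by norm_num [heavyBound]) hM
  have hρs : √(m : ℝ) ≤ ρ := by nlinarith
  refine isBook_of_entries_le (x := fun a => x a / x u) (ρ := ρ) hiso huv
    (fun a => div_nonneg (hx a) hxu.le) (div_self hxu.ne') ((div_le_one hxu).2 (hu' v))
    (fun w hwu hwv => ?_) (fun a => ?_) hm (by linarith) hρm hodd
  · have := third_entry_le hG huv hwu hwv hx hu' hv' hxu hm heig hρs hM
    rw [div_le_iff₀ hxu]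
    linarith
  · simp only [← mul_div_assoc, ← Finset.sum_div]
    rw [heig]

end

/-! ### Planarity of graphs covered by two vertices. -/

section Drawing

variable {V : Type*}

/-- A graph all of whose edges meet a fixed pair of vertices is planar. -/
theorem isPlanar_of_two_cover [Finite V] {G : SimpleGraph V} {u v : V} (huv : u ≠ v)
    (hcov : ∀ a b, G.Adj a b → (a = u ∨ a = v) ∨ (b = u ∨ b = v)) : IsPlanar G := by
  classical
  obtain ⟨k, hk, hk0⟩ : ∃ k : V → ℝ, Function.Injective k ∧ ∀ a, 0 < k a := by
    refine ⟨fun a => (Finite.equivFin V a : ℕ) + 1, fun a b h => ?_, fun a => by positivity⟩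
    have : ((Finite.equivFin V a : ℕ) : ℝ) = (Finite.equivFin V b : ℕ) := by
      simpa using h
    exact (Finite.equivFin V).injective (Fin.ext (by exact_mod_cast this))
  -- `u` and `v` lie at $(0,\pm1)$ and all other vertices at distinct points of the positive
  -- horizontal axis; every edge is a straight segment.
  set pt : V → ℝ × ℝ := fun a => if a = u then (0, 1) else if a = v then (0, -1) else (k a, 0)
    with hpt
  have ptu : pt u = (0, 1) := by simp [hpt]
  have ptv : pt v = (0, -1) := by simp [hpt, huv.symm]
  have ptb : ∀ b, b ≠ u → b ≠ v → pt b = (k b, 0) := fun b h1 h2 => by simp [hpt, h1, h2]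
  have hcase : ∀ w, (w = u ∧ pt w = (0, 1)) ∨ (w = v ∧ pt w = (0, -1)) ∨ pt w = (k w, 0) := by
    intro w
    by_cases hu : w = u
    · exact Or.inl ⟨hu, hu ▸ ptu⟩
    by_cases hv : w = v
    · exact Or.inr (Or.inl ⟨hv, hv ▸ ptv⟩)
    exact Or.inr (Or.inr (ptb w hu hv))
  have harc : ∀ e : G.edgeSet, ∃ α : C(unitInterval, ℝ × ℝ),
      (e.1 = s(u, v) ∧ ∀ t, α t = (0, 1 - 2 * (t : ℝ))) ∨
      (∃ b, b ≠ u ∧ b ≠ v ∧ e.1 = s(u, b) ∧ ∀ t, α t = (t * k b, 1 - (t : ℝ))) ∨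
      (∃ b, b ≠ u ∧ b ≠ v ∧ e.1 = s(v, b) ∧ ∀ t, α t = (t * k b, (t : ℝ) - 1)) := by
    have main : ∀ a b, G.Adj a b → (a = u ∨ a = v) → ∃ α : C(unitInterval, ℝ × ℝ),
      (s(a, b) = s(u, v) ∧ ∀ t, α t = (0, 1 - 2 * (t : ℝ))) ∨
      (∃ b', b' ≠ u ∧ b' ≠ v ∧ s(a, b) = s(u, b') ∧ ∀ t, α t = (t * k b', 1 - (t : ℝ))) ∨
      (∃ b', b' ≠ u ∧ b' ≠ v ∧ s(a, b) = s(v, b') ∧ ∀ t, α t = (t * k b', (t : ℝ) - 1)) := by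
      rintro a b hab (rfl | rfl)
      · by_cases hb : b = v
        · subst hb
          exact ⟨⟨fun t => (0, 1 - 2 * t), by fun_prop⟩, Or.inl ⟨rfl, fun t => rfl⟩⟩
        · exact ⟨⟨fun t => (t * k b, 1 - t), by fun_prop⟩,
            Or.inr (Or.inl ⟨b, hab.ne', hb, rfl, fun t => rfl⟩)⟩
      · by_cases hb : b = u
        · subst hb
          exact ⟨⟨fun t => (0, 1 - 2 * t), by fun_prop⟩, Or.inl ⟨Sym2.eq_swap, fun t => rfl⟩⟩
        · exact ⟨⟨fun t => (t * k b, t - 1), by fun_prop⟩,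
            Or.inr (Or.inr ⟨b, hb, hab.ne', rfl, fun t => rfl⟩)⟩
    rintro ⟨e, he⟩
    induction e using Sym2.ind with
    | _ a b =>
      rcases hcov a b he with h | h
      · exact main a b he h
      · simp only [Sym2.eq_swap (a := a) (b := b)]
        exact main b a he.symm h
  choose arc harc using harc
  refine ⟨⟨pt, arc, ?_, ?_, ?_, ?_, ?_⟩⟩
  · intro a b h
    rcases hcase a with ⟨ha, h1⟩ | ⟨ha, h1⟩ | h1 <;>
      rcases hcase b with ⟨hb, h2⟩ | ⟨hb, h2⟩ | h2 <;>
      rw [h1, h2, Prod.mk.injEq] at h <;> obtain ⟨hX, hY⟩ := h <;>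
      first | exact ha.trans hb.symm | exact hk hX | norm_num at hY
  · intro e s t hst
    rcases harc e with ⟨-, h⟩ | ⟨b, -, -, -, h⟩ | ⟨b, -, -, -, h⟩ <;>
      · rw [h, h, Prod.mk.injEq] at hst
        exact Subtype.ext (by linarith [hst.2])
  · intro e
    have himg : ∀ a b, pt '' {w | w ∈ s(a, b)} = {pt a, pt b} := fun a b => by
      ext z; simp [eq_comm]
    rcases harc e with ⟨he, h⟩ | ⟨b, h1, h2, he, h⟩ | ⟨b, h1, h2, he, h⟩
    · rw [he, himg, ptu, ptv, h, h]; norm_num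
    · rw [he, himg, ptu, ptb b h1 h2, h, h]; norm_num
    · rw [he, himg, ptv, ptb b h1 h2, h, h]; norm_num
  · intro e t w hw
    have ht0 := t.2.1
    have ht1 := t.2.2
    have hkw := hk0 w
    have hpw := hcase w
    rcases harc e with ⟨he, h⟩ | ⟨b, h1, h2, he, h⟩ | ⟨b, h1, h2, he, h⟩ <;>
      rw [he, Sym2.mem_iff] <;> rw [h] at hw <;>
      rcases hpw with ⟨hwe, hp⟩ | ⟨hwe, hp⟩ | hp <;> rw [hp, Prod.mk.injEq] at hw <;>
      obtain ⟨hX, hY⟩ := hw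
    · exact Or.inl hwe
    · exact Or.inr hwe
    · exact absurd hX hkw.ne
    · exact Or.inl hwe
    · linarith
    · right; apply hk; rw [← hX, show (t : ℝ) = 1 by linarith, one_mul]
    · linarith
    · exact Or.inl hwe
    · right; apply hk; rw [← hX, show (t : ℝ) = 1 by linarith, one_mul]
  · intro e f s t hef hst
    have hs0 := s.2.1
    have hs1 := s.2.2
    have ht0 := t.2.1
    have ht1 := t.2.2
    have hzero : ∀ (r c : ℝ), 0 < c → 0 = r * c → r = 0 := fun r c hc h =>
      (mul_eq_zero.1 h.symm).resolve_right hc.ne'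
    have same : ∀ (r r' : ℝ) (b b' : V), r * k b = r' * k b' → r = r' → r = 0 ∨ b = b' :=
      fun r r' b b' h hr => by
        by_cases h0 : r = 0
        · exact Or.inl h0
        · subst hr; exact Or.inr (hk (mul_left_cancel₀ h0 h))
    rcases harc e with ⟨he, h⟩ | ⟨b, h1, h2, he, h⟩ | ⟨b, h1, h2, he, h⟩ <;>
      rcases harc f with ⟨hf, h'⟩ | ⟨b', h1', h2', hf, h'⟩ | ⟨b', h1', h2', hf, h'⟩ <;>
      have hst' := hst <;> rw [h, h', Prod.mk.injEq] at hst' <;> obtain ⟨hX, hY⟩ := hst'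
    · exact absurd (Subtype.ext (he.trans hf.symm)) hef
    · have := hzero _ _ (hk0 b') hX
      exact ⟨u, by simp [he], by simp [hf], by rw [hst, h', ptu, this]; norm_num⟩
    · have := hzero _ _ (hk0 b') hX
      exact ⟨v, by simp [he], by simp [hf], by rw [hst, h', ptv, this]; norm_num⟩
    · have := hzero _ _ (hk0 b) hX.symm
      exact ⟨u, by simp [he], by simp [hf], by rw [h, ptu, this]; norm_num⟩
    · rcases same _ _ _ _ hX (by linarith) with h0 | rfl
      · exact ⟨u, by simp [he], by simp [hf], by rw [h, ptu, h0]; norm_num⟩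
      · exact absurd (Subtype.ext (he.trans hf.symm)) hef
    · have hs : (s : ℝ) = 1 := by linarith
      have ht : (t : ℝ) = 1 := by linarith
      rcases same _ _ _ _ hX (hs.trans ht.symm) with h0 | rfl
      · linarith
      · exact ⟨b, by simp [he], by simp [hf], by rw [h, ptb b h1 h2, hs]; norm_num⟩
    · have := hzero _ _ (hk0 b) hX.symm
      exact ⟨v, by simp [he], by simp [hf], by rw [h, ptv, this]; norm_num⟩
    · have hs : (s : ℝ) = 1 := by linarith
      have ht : (t : ℝ) = 1 := by linarith
      rcases same _ _ _ _ hX (hs.trans ht.symm) with h0 | rfl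
      · linarith
      · exact ⟨b, by simp [he], by simp [hf], by rw [h, ptb b h1 h2, hs]; norm_num⟩
    · rcases same _ _ _ _ hX (by linarith) with h0 | rfl
      · exact ⟨v, by simp [he], by simp [hf], by rw [h, ptv, h0]; norm_num⟩
      · exact absurd (Subtype.ext (he.trans hf.symm)) hef

end Drawing

/-! ### Books: uniqueness, forbidden subgraphs, identification with $G_m$. -/

section Book

variable {V W : Type*} {G : SimpleGraph V} {H : SimpleGraph W} {c i m : ℕ}

theorem IsBook.of_iso (hH : IsBook H c i) (e : G ≃g H) : IsBook G c i := by
  obtain ⟨f, hf, hc⟩ := hH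
  refine ⟨f ∘ e, fun a b => ?_, fun k => ?_⟩
  · rw [← e.map_adj_iff, hf, e.injective.ne_iff]; rfl
  · rw [← hc]
    exact Nat.card_congr (e.toEquiv.subtypeEquiv fun a => Iff.rfl)

/-- Adjacency depends only on the classes, so any bijection matching the classes is an isomorphism.
-/
theorem IsBook.nonempty_iso [Finite V] [Finite W] (hG : IsBook G c i) (hH : IsBook H c i) :
    Nonempty (G ≃g H) := by
  obtain ⟨f, hf, hfc⟩ := hG
  obtain ⟨g, hg, hgc⟩ := hH
  have e : ∀ k, Nonempty ({a // f a = k} ≃ {b // g b = k}) := fun k =>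
    Finite.card_eq.1 ((hfc k).trans (hgc k).symm)
  replace e := fun k => (e k).some
  refine ⟨⟨Equiv.ofFiberEquiv e, fun {a b} => ?_⟩⟩
  rw [hf, hg, Equiv.ofFiberEquiv_map (f := f) (g := g), Equiv.ofFiberEquiv_map (f := f) (g := g),
    (Equiv.ofFiberEquiv e).injective.ne_iff]

theorem IsBook.exists_spine (hG : IsBook G c i) :
    ∃ u v, u ≠ v ∧ G.Adj u v ∧ (∀ a, a ≠ u → G.Adj u a) ∧
      ∀ a b, G.Adj a b → (a = u ∨ a = v) ∨ (b = u ∨ b = v) := by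
  obtain ⟨f, hf, hc⟩ := hG
  obtain ⟨⟨u, hu⟩, hu'⟩ := Nat.card_eq_one_iff_exists.1 (hc 0)
  obtain ⟨⟨v, hv⟩, hv'⟩ := Nat.card_eq_one_iff_exists.1 (hc 1)
  have hu'' : ∀ a, f a = 0 → a = u := fun a ha => congrArg Subtype.val (hu' ⟨a, ha⟩)
  have hv'' : ∀ a, f a = 1 → a = v := fun a ha => congrArg Subtype.val (hv' ⟨a, ha⟩)
  have huv : u ≠ v := fun h => by rw [h, hv] at hu; exact absurd hu (by decide)
  refine ⟨u, v, huv, (hf _ _).2 ⟨huv, Or.inl hu⟩, fun a ha => (hf _ _).2 ⟨ha.symm, Or.inl hu⟩,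
    fun a b hab => ?_⟩
  rcases ((hf _ _).1 hab).2 with h | h | ⟨h, -⟩ | ⟨-, h⟩
  · exact Or.inl (Or.inl (hu'' _ h))
  · exact Or.inr (Or.inl (hu'' _ h))
  · exact Or.inl (Or.inr (hv'' _ h))
  · exact Or.inr (Or.inr (hv'' _ h))

theorem IsBook.isPlanar [Finite V] (hG : IsBook G c i) : IsPlanar G := by
  obtain ⟨u, v, huv, -, -, hcov⟩ := hG.exists_spine
  exact isPlanar_of_two_cover huv hcov

theorem IsBook.not_isIsolated (hG : IsBook G c i) (a : V) : ¬ G.IsIsolated a := by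
  obtain ⟨u, v, huv, hadj, hall, -⟩ := hG.exists_spine
  intro h
  by_cases ha : a = u
  · subst ha; exact h v hadj
  · exact h u (hall a ha).symm

/-- A graph with no vertex cover of size two is not contained in a book. -/
theorem IsBook.free [hW : Nonempty W] {F : SimpleGraph W} (hG : IsBook G c i)
    (hF : ∀ a b : W, ∃ x y, F.Adj x y ∧ x ≠ a ∧ x ≠ b ∧ y ≠ a ∧ y ≠ b) : F.Free G := by
  rintro ⟨φ⟩
  obtain ⟨u, v, -, -, -, hcov⟩ := hG.exists_spine
  -- The copy meets each spine vertex in at most one vertex of `F`; an arbitrary vertex serves when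
  -- there is none.
  have hpre : ∀ z : V, ∃ a : W, ∀ x, x ≠ a → φ.toHom x ≠ z := by
    intro z
    obtain ⟨w⟩ := hW
    by_cases h : ∃ a, φ.toHom a = z
    · obtain ⟨a, rfl⟩ := h
      exact ⟨a, fun x hx => φ.injective'.ne hx⟩
    · exact ⟨w, fun x _ hx => h ⟨x, hx⟩⟩
  obtain ⟨a, ha⟩ := hpre u
  obtain ⟨b, hb⟩ := hpre v
  obtain ⟨x, y, hxy, hxa, hxb, hya, hyb⟩ := hF a b
  rcases hcov _ _ (φ.toHom.map_adj hxy) with (h | h) | (h | h)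
  · exact ha x hxa h
  · exact hb x hxb h
  · exact ha y hya h
  · exact hb y hyb h

theorem cycleGraph_exists_edge {l : ℕ} (hl : 5 ≤ l) (a b : Fin l) :
    ∃ x y, (cycleGraph l).Adj x y ∧ x ≠ a ∧ x ≠ b ∧ y ≠ a ∧ y ≠ b := by
  obtain ⟨n, rfl⟩ : ∃ n, l = n + 2 := ⟨l - 2, by omega⟩
  -- The edge from `x` to `x + 1` avoids `a` and `b` as soon as `x` avoids four vertices, hence
  -- $l\ge5$.
  obtain ⟨x, hx⟩ : ∃ x, x ∉ ({a, b, a - 1, b - 1} : Finset (Fin (n + 2))) := by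
    by_contra! h
    have h1 : Finset.univ ⊆ ({a, b, a - 1, b - 1} : Finset (Fin (n + 2))) := fun x _ => h x
    have h2 := Finset.card_le_card h1
    have h3 : ({a, b, a - 1, b - 1} : Finset (Fin (n + 2))).card ≤ 4 := Finset.card_le_four
    rw [Finset.card_univ, Fintype.card_fin] at h2
    omega
  simp only [Finset.mem_insert, Finset.mem_singleton, not_or] at hx
  refine ⟨x, x + 1, ?_, hx.1, hx.2.1, fun h => hx.2.2.1 ?_, fun h => hx.2.2.2 ?_⟩
  · rw [cycleGraph_adj]; right; abel
  · rw [← h]; abel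
  · rw [← h]; abel

theorem completeGraph_four_exists_edge (a b : Fin 4) :
    ∃ x y, (completeGraph (Fin 4)).Adj x y ∧ x ≠ a ∧ x ≠ b ∧ y ≠ a ∧ y ≠ b := by
  simp only [completeGraph, top_adj]
  revert a b
  decide

theorem matching_exists_edge {t : ℕ} (ht : 3 ≤ t) (a b : Fin t × Fin 2) :
    ∃ x y, (matching t).Adj x y ∧ x ≠ a ∧ x ≠ b ∧ y ≠ a ∧ y ≠ b := by
  obtain ⟨j, hj⟩ : ∃ j, j ∉ ({a.1, b.1} : Finset (Fin t)) := by
    by_contra! h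
    have h1 : Finset.univ ⊆ ({a.1, b.1} : Finset (Fin t)) := fun x _ => h x
    have h2 := Finset.card_le_card h1
    have h3 : ({a.1, b.1} : Finset (Fin t)).card ≤ 2 := Finset.card_le_two
    rw [Finset.card_univ, Fintype.card_fin] at h2
    omega
  simp only [Finset.mem_insert, Finset.mem_singleton, not_or] at hj
  exact ⟨(j, 0), (j, 1), ⟨rfl, by simp⟩, fun h => hj.1 (h ▸ rfl), fun h => hj.2 (h ▸ rfl),
    fun h => hj.1 (h ▸ rfl), fun h => hj.2 (h ▸ rfl)⟩

theorem nat_card_subtype_sum {α β : Type*} [Finite α] [Finite β] (p : α ⊕ β → Prop) :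
    Nat.card {a // p a} = Nat.card {a // p (Sum.inl a)} + Nat.card {b // p (Sum.inr b)} := by
  rw [Nat.card_congr Equiv.subtypeSum, Nat.card_sum]

theorem isBook_join_two (k : ℕ) :
    IsBook (join (completeGraph (Fin 2)) (emptyGraph (Fin k))) k 0 := by
  refine ⟨Sum.elim (fun j => if j = 0 then 0 else 1) fun _ => 2, ?_, fun j => ?_⟩
  · rintro (a | a) (b | b)
    · fin_cases a <;> fin_cases b <;> simp [join, bookRel, completeGraph]
    · fin_cases a <;> simp [join, bookRel]
    · fin_cases b <;> simp [join, bookRel]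
    · simp [join, bookRel]
  · rw [nat_card_subtype_sum]
    simp only [Sum.elim_inl, Sum.elim_inr, Nat.card_eq_fintype_card, Fintype.card_subtype]
    fin_cases j <;> simp [Fin.card_filter_univ_succ]

theorem isBook_join_one (k : ℕ) :
    IsBook (join (completeGraph (Fin 1)) (star k ⊕g completeGraph (Fin 1))) k 1 := by
  refine ⟨Sum.elim (fun _ => 0) (Sum.elim (fun j => if j = 0 then 1 else 2) fun _ => 3), ?_,
    fun j => ?_⟩
  · rintro (a | a | a) (b | b | b)
    · simp [join, bookRel, completeGraph, Subsingleton.elim a b]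
    · simp [join, bookRel]
    · simp [join, bookRel]
    · simp [join, bookRel]
    · by_cases ha : a = 0 <;> by_cases hb : b = 0 <;> simp [join, bookRel, star, ha, hb, Ne.symm]
    · by_cases ha : a = 0 <;> simp [join, bookRel, ha]
    · simp [join, bookRel]
    · by_cases hb : b = 0 <;> simp [join, bookRel, hb]
    · simp [join, bookRel, completeGraph, Subsingleton.elim a b]
  · rw [nat_card_subtype_sum, nat_card_subtype_sum]
    simp only [Sum.elim_inl, Sum.elim_inr, Nat.card_eq_fintype_card, Fintype.card_subtype]
    fin_cases j <;> simp [Fin.card_filter_univ_succ, Fin.succ_ne_zero]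

theorem isGm_iff_isBook [Finite V] (hm : m = 2 * c + 1 + i) (h1 : Odd m → i = 0)
    (h2 : ¬ Odd m → i = 1) : IsGm m G ↔ IsBook G c i := by
  unfold IsGm
  split_ifs with ho
  · obtain rfl := h1 ho
    rw [show (m - 1) / 2 = c by omega]
    exact ⟨fun ⟨e⟩ => (isBook_join_two c).of_iso e, fun h => h.nonempty_iso (isBook_join_two c)⟩
  · obtain rfl := h2 ho
    rw [show (m - 2) / 2 = c by omega]
    exact ⟨fun ⟨e⟩ => (isBook_join_one c).of_iso e, fun h => h.nonempty_iso (isBook_join_one c)⟩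

end Book

/-! ### Lower bounds for the spectral radius of a book. -/

section BookSpectrum

variable {V : Type*} [Fintype V] {G : SimpleGraph V} {c i : ℕ}

theorem sum_comp_eq_of_card_fiber {f : V → Fin 4}
    (hf : ∀ k, Nat.card {a // f a = k} = ![1, 1, c, i] k) (h : Fin 4 → ℝ) :
    ∑ a, h (f a) = h 0 + h 1 + c * h 2 + i * h 3 := by
  classical
  have hc : ∀ k, (Finset.univ.filter fun a => f a = k).card = ![1, 1, c, i] k := fun k => by
    rw [← hf, Nat.card_eq_fintype_card, Fintype.card_subtype]
  rw [← Finset.sum_fiberwise Finset.univ f, Fin.sum_univ_four]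
  have e : ∀ k, ∑ a with f a = k, h (f a) = (![1, 1, c, i] k : ℕ) * h k := fun k => by
    rw [Finset.sum_congr rfl fun a ha => by rw [(Finset.mem_filter.1 ha).2], Finset.sum_const, hc,
      nsmul_eq_mul]
  simp [e]

/-- The last term removes the vertex itself, since `bookRel 0 0` holds. -/
theorem sum_adjInd_comp {f : V → Fin 4} (hadj : ∀ a b, G.Adj a b ↔ a ≠ b ∧ bookRel (f a) (f b))
    (hf : ∀ k, Nat.card {a // f a = k} = ![1, 1, c, i] k) (h : Fin 4 → ℝ) (a : V) :
    ∑ b, adjInd G a b * h (f b) =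
      ((if bookRel (f a) 0 then h 0 else 0) + (if bookRel (f a) 1 then h 1 else 0)
        + c * (if bookRel (f a) 2 then h 2 else 0) + i * (if bookRel (f a) 3 then h 3 else 0))
        - if bookRel (f a) (f a) then h (f a) else 0 := by
  classical
  rw [← sum_comp_eq_of_card_fiber hf fun k => if bookRel (f a) k then h k else 0, eq_sub_iff_add_eq]
  have e : ∀ b, (if bookRel (f a) (f b) then h (f b) else 0) = adjInd G a b * h (f b)
      + if a = b then (if bookRel (f a) (f a) then h (f a) else 0) else 0 := fun b => by
    by_cases hab : a = b
    · subst hab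
      rw [if_pos rfl, adjInd, if_neg (SimpleGraph.irrefl G), zero_mul, zero_add]
    · by_cases hr : bookRel (f a) (f b)
      · rw [adjInd, if_pos ((hadj a b).2 ⟨hab, hr⟩), if_pos hr, if_neg hab]; ring
      · rw [adjInd, if_neg fun h' => hr ((hadj a b).1 h').2, if_neg hr, if_neg hab]; ring
  rw [Finset.sum_congr rfl fun b _ => e b, Finset.sum_add_distrib, Finset.sum_ite_eq,
    if_pos (Finset.mem_univ _)]

theorem IsBook.ncard_edgeSet (hG : IsBook G c i) : G.edgeSet.ncard = 2 * c + 1 + i := by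
  obtain ⟨f, hadj, hf⟩ := hG
  have h := sum_adjInd_eq_two_mul_ncard G
  have e : ∀ a, ∑ b, adjInd G a b = (![(c : ℝ) + i + 1, c + 1, 2, 1] : Fin 4 → ℝ) (f a) := fun a => by
    have := sum_adjInd_comp hadj hf (fun _ => 1) a
    simp only [mul_one] at this
    rw [this]
    generalize f a = k
    fin_cases k <;> simp [bookRel]
    · ring
    · ring
    · norm_num
  simp_rw [e] at h
  rw [sum_comp_eq_of_card_fiber hf] at h
  simp at h
  have : (G.edgeSet.ncard : ℝ) = 2 * c + 1 + i := by linarith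
  exact_mod_cast this

theorem IsBook.le_rho (hG : IsBook G c i) {μ : ℝ} (hμ : 0 < μ) (g : Fin 4 → ℝ)
    (hg : ∀ k, 0 ≤ g k) (hg0 : g 0 ≠ 0) (h0 : μ * g 0 ≤ g 1 + c * g 2 + i * g 3)
    (h1 : μ * g 1 ≤ g 0 + c * g 2) (h2 : μ * g 2 ≤ g 0 + g 1) (h3 : μ * g 3 ≤ g 0) :
    ENNReal.ofReal μ ≤ rho G := by
  classical
  obtain ⟨f, hadj, hf⟩ := hG
  obtain ⟨⟨u, hu⟩, -⟩ := Nat.card_eq_one_iff_exists.1 (hf 0)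
  refine le_rho_of_subeigenvector G hμ.le (fun a => g (f a)) (fun a => hg _) ⟨u, by rwa [hu]⟩
    fun a => ?_
  have e : (∑ b, if G.Adj a b then g (f b) else 0) = ∑ b, adjInd G a b * g (f b) :=
    Finset.sum_congr rfl fun b _ => by unfold adjInd; split_ifs <;> simp
  rw [e, sum_adjInd_comp hadj hf]
  generalize f a = k
  fin_cases k <;> simp [bookRel] <;> linarith

theorem IsBook.exists_le_rho_of_zero (hG : IsBook G c 0) :
    ∃ μ : ℝ, 0 < μ ∧ μ ^ 2 - μ = 2 * c ∧ ENNReal.ofReal μ ≤ rho G := by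
  set s := √(1 + 8 * (c : ℝ)) with hs
  have hs2 : s ^ 2 = 1 + 8 * c := Real.sq_sqrt (by positivity)
  have hs0 : 0 ≤ s := Real.sqrt_nonneg _
  have hμ : 0 < (1 + s) / 2 := by positivity
  have hq : ((1 + s) / 2) ^ 2 - (1 + s) / 2 = 2 * c := by linarith
  refine ⟨(1 + s) / 2, hμ, hq, ?_⟩
  set μ := (1 + s) / 2
  have hc : (c : ℝ) * (2 / μ) = μ - 1 := by field_simp; linarith
  refine hG.le_rho hμ ![1, 1, 2 / μ, 1 / μ] (fun k => ?_) (by simp) ?_ ?_ ?_ ?_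
  · fin_cases k <;> simp <;> positivity
  · simp; linarith
  · simp; linarith
  · simp; field_simp; norm_num
  · simp; field_simp; rfl

/-- The constant 0.4 is below $1/2$, so the test vector works, and above the $0.2=2-1.8$ that an
edge off the spine would allow. The entry `y` is the one an exact eigenvector would have by the
relation $(1-y)\mu(\mu+1)=1$. -/
theorem IsBook.exists_le_rho_of_one (hG : IsBook G c 1) :
    ∃ μ : ℝ, 0 < μ ∧ μ ^ 2 - μ = 2 * c + 0.4 ∧ ENNReal.ofReal μ ≤ rho G := by
  set s := √(2.6 + 8 * (c : ℝ)) with hs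
  have hs2 : s ^ 2 = 2.6 + 8 * c := Real.sq_sqrt (by positivity)
  have hs0 : 0 ≤ s := Real.sqrt_nonneg _
  have hμ : 0 < (1 + s) / 2 := by positivity
  have hq : ((1 + s) / 2) ^ 2 - (1 + s) / 2 = 2 * c + 0.4 := by linarith
  refine ⟨(1 + s) / 2, hμ, hq, ?_⟩
  set μ := (1 + s) / 2
  have hμ1 : 1 < μ := by
    have : 0 ≤ (c : ℝ) := Nat.cast_nonneg _
    nlinarith
  set y := 1 - 1 / (μ * (μ + 1)) with hy
  have hyμ : (1 - y) * (μ * (μ + 1)) = 1 := by rw [hy]; field_simp; ring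
  have hy0 : 0 ≤ y := by
    rw [hy, sub_nonneg, div_le_one (by positivity)]; nlinarith
  have hyμ' : (1 - y) * (μ + 1) = 1 / μ := by rw [hy]; field_simp; ring
  have hkey : μ * y ≤ 1 + c * ((1 + y) / μ) := by
    have : μ * (μ * y) ≤ μ * (1 + c * ((1 + y) / μ)) := by
      have e : μ * (1 + c * ((1 + y) / μ)) = μ + c * (1 + y) := by field_simp
      rw [e]
      have hc : (c : ℝ) = (μ ^ 2 - μ - 0.4) / 2 := by linarith
      have hy1 : y ≤ 1 := by
        rw [hy]; have : 0 ≤ 1 / (μ * (μ + 1)) := by positivity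
        linarith
      rw [hc]
      nlinarith
    exact le_of_mul_le_mul_left this hμ
  refine hG.le_rho hμ ![1, y, (1 + y) / μ, 1 / μ] (fun k => ?_) (by simp) ?_ ?_ ?_ ?_
  · fin_cases k <;> simp <;> positivity
  · simp [-one_div]; linarith
  · simp; linarith
  · simp; field_simp; rfl
  · simp; field_simp; rfl

end BookSpectrum

/-! ### Assembly. -/

section Main

universe v

theorem exists_isBook (c i : ℕ) (hi : i = 0 ∨ i = 1) :
    ∃ (V : Type v) (_ : Fintype V) (G : SimpleGraph V), IsBook G c i := by
  rcases hi with rfl | rfl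
  · exact ⟨_, inferInstance, _, (isBook_join_two c).of_iso (Iso.comap Equiv.ulift.{v} _)⟩
  · exact ⟨_, inferInstance, _, (isBook_join_one c).of_iso (Iso.comap Equiv.ulift.{v} _)⟩

theorem IsBook.exists_le_rho {V : Type*} [Fintype V] {G : SimpleGraph V} {m c i : ℕ}
    (hG : IsBook G c i) (hm : m = 2 * c + 1 + i) (h1 : Odd m → i = 0) (h2 : ¬ Odd m → i = 1) :
    ∃ μ : ℝ, 0 < μ ∧ (m : ℝ) - 1.6 ≤ μ ^ 2 - μ ∧ (Odd m → (m : ℝ) - 1 ≤ μ ^ 2 - μ) ∧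
      ENNReal.ofReal μ ≤ rho G := by
  by_cases ho : Odd m
  · obtain rfl := h1 ho
    obtain ⟨μ, h0, hq, hr⟩ := hG.exists_le_rho_of_zero
    refine ⟨μ, h0, ?_, fun _ => ?_, hr⟩ <;> rw [hq, hm] <;> push_cast <;> linarith
  · obtain rfl := h2 ho
    obtain ⟨μ, h0, hq, hr⟩ := hG.exists_le_rho_of_one
    refine ⟨μ, h0, ?_, fun h => absurd h ho, hr⟩
    rw [hq, hm]; push_cast; linarith

theorem isGm_of_le_rho {V : Type*} [Fintype V] {G : SimpleGraph V} {m : ℕ} {μ : ℝ}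
    (hplanar : IsPlanar G) (hcard : G.edgeSet.ncard = m) (hiso : ∀ v, ¬ G.IsIsolated v)
    (hM : 5000 * (heavyBound + 4 * heavyBound ^ 4) ≤ √m) (hμ0 : 0 < μ)
    (hμ : (m : ℝ) - 1.6 ≤ μ ^ 2 - μ) (hodd : Odd m → (m : ℝ) - 1 ≤ μ ^ 2 - μ)
    (hρ : ENNReal.ofReal μ ≤ rho G) : IsGm m G := by
  have hs : (5000 : ℝ) ≤ √m := le_trans (by norm_num [heavyBound]) hM
  have hsq : √(m : ℝ) ^ 2 = m := Real.sq_sqrt (Nat.cast_nonneg _)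
  have hV : Nonempty V := by
    by_contra h
    rw [not_nonempty_iff] at h
    have : G.edgeSet = ∅ := Set.eq_empty_of_forall_notMem fun e => by
      induction e using Sym2.ind with
      | _ a b => exact isEmptyElim a
    rw [this, Set.ncard_empty] at hcard
    rw [← hcard] at hs
    norm_num at hs
  obtain ⟨r, x, hr0, hr, hx, hx0, heig⟩ := exists_eigenvector_rho G
  rw [hr, ENNReal.ofReal_le_ofReal_iff hr0] at hρ
  have hμ1 : 1 ≤ μ := by nlinarith
  have hmono : μ ^ 2 - μ ≤ r ^ 2 - r := by nlinarith
  obtain ⟨c, i, hB, hm, h1, h2⟩ := isBook_of_eigenvector hplanar.not_hasK33 hiso hx hx0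
    (fun a => by
      rw [← heig]
      exact Finset.sum_congr rfl fun b _ => by simp only [adjInd, ite_mul, one_mul, zero_mul])
    hr0 (m := m) (by rw [sum_adjInd_eq_two_mul_ncard, hcard]) hM (hμ.trans hmono)
    fun ho => (hodd ho).trans hmono
  exact (isGm_iff_isBook hm h1 h2).2 hB

/-- A maximiser does at least as well as the book, so it is one. Conversely, a graph beating the
book would itself be that book up to isomorphism, with the same radius; no separate existence
argument for the maximum is needed. -/
theorem isSPEX_iff_isGm {V : Type v} [Fintype V] {W : Type*} [Nonempty W] {F : SimpleGraph W}
    {G : SimpleGraph V} {m : ℕ} (hM : 5000 * (heavyBound + 4 * heavyBound ^ 4) ≤ √m)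
    (hF : ∀ a b : W, ∃ x y, F.Adj x y ∧ x ≠ a ∧ x ≠ b ∧ y ≠ a ∧ y ≠ b) :
    IsSPEX m F G ↔ IsGm m G := by
  have hs : (5000 : ℝ) ≤ √m := le_trans (by norm_num [heavyBound]) hM
  have hm2 : 2 ≤ m := by
    by_contra! h
    have : (m : ℝ) ≤ 1 := by exact_mod_cast Nat.le_of_lt_succ h
    have := Real.sqrt_le_sqrt this
    rw [Real.sqrt_one] at this
    linarith
  obtain ⟨c, i, hm, h1, h2⟩ : ∃ c i, m = 2 * c + 1 + i ∧ (Odd m → i = 0) ∧ (¬ Odd m → i = 1) := by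
    by_cases ho : Odd m
    · obtain ⟨k, hk⟩ := ho
      exact ⟨k, 0, by omega, fun _ => rfl, fun h => absurd ⟨k, hk⟩ h⟩
    · have he := Nat.not_odd_iff_even.1 ho
      obtain ⟨k, hk⟩ := he
      exact ⟨k - 1, 1, by omega, fun h => absurd h ho, fun _ => rfl⟩
  have hadm : ∀ {V' : Type v} [Fintype V'] {G' : SimpleGraph V'}, IsBook G' c i →
      IsAdmissible m F G' := fun hB =>
    ⟨hB.isPlanar, hB.ncard_edgeSet.trans hm.symm, hB.not_isIsolated, hB.free hF⟩
  constructor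
  · rintro ⟨hA, hmax⟩
    obtain ⟨V', _, H, hH⟩ := exists_isBook.{v} c i (by tauto)
    obtain ⟨μ, hμ0, hμ, hodd, hle⟩ := hH.exists_le_rho hm h1 h2
    exact isGm_of_le_rho hA.planar hA.card_edges hA.not_isolated hM hμ0 hμ hodd
      (hle.trans (hmax V' H (hadm hH)))
  · intro hG
    have hB := (isGm_iff_isBook hm h1 h2).1 hG
    refine ⟨hadm hB, fun V' _ G' hA => ?_⟩
    by_contra! hlt
    obtain ⟨μ, hμ0, hμ, hodd, hle⟩ := hB.exists_le_rho hm h1 h2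
    have hG' := isGm_of_le_rho hA.planar hA.card_edges hA.not_isolated hM hμ0 hμ hodd
      (hle.trans hlt.le)
    obtain ⟨e⟩ := ((isGm_iff_isBook hm h1 h2).1 hG').nonempty_iso hB
    exact hlt.ne' (rho_eq_of_iso e)

end Main

end PlanarSpex

theorem mainTheorem3 :
    ∃ m₀ : ℕ, ∀ m ≥ m₀, ∀ (V : Type*) [Fintype V] (G : SimpleGraph V),
      (∀ l ≥ 5, PlanarSpex.IsSPEX m (SimpleGraph.cycleGraph l) G ↔ PlanarSpex.IsGm m G) ∧
      (PlanarSpex.IsSPEX m (SimpleGraph.completeGraph (Fin 4)) G ↔ PlanarSpex.IsGm m G) ∧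
      (∀ t ≥ 3, PlanarSpex.IsSPEX m (PlanarSpex.matching t) G ↔ PlanarSpex.IsGm m G) := by
  -- The threshold involves only `heavyBound`, so it is uniform in `l` and `t`.
  obtain ⟨m₀, hm₀⟩ := exists_nat_ge
    ((5000 * (PlanarSpex.heavyBound + 4 * PlanarSpex.heavyBound ^ 4)) ^ 2)
  refine ⟨m₀, fun m hm V _ G => ?_⟩
  have hM : 5000 * (PlanarSpex.heavyBound + 4 * PlanarSpex.heavyBound ^ 4) ≤ √m :=
    Real.le_sqrt_of_sq_le (hm₀.trans (by exact_mod_cast hm))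
  refine ⟨fun l hl => ?_, ?_, fun t ht => ?_⟩
  · have : Nonempty (Fin l) := ⟨⟨0, by omega⟩⟩
    exact PlanarSpex.isSPEX_iff_isGm hM (PlanarSpex.cycleGraph_exists_edge hl)
  · exact PlanarSpex.isSPEX_iff_isGm hM PlanarSpex.completeGraph_four_exists_edge
  · have : Nonempty (Fin t × Fin 2) := ⟨⟨0, by omega⟩, 0⟩
    exact PlanarSpex.isSPEX_iff_isGm hM (PlanarSpex.matching_exists_edge ht)
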